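/- Let $k$ be a ring and let $X$ be a connected, locally simply connected topological space. Here a space is called simply connected if it is connected and every covering of it is trivial, and locally simply connected if every point has a basis of simply connected open neighbourhoods. Let $\phi\colon\widetilde X\to X$ be a universal covering (a covering with simply connected total space) and let $G=\operatorname{Aut}_X\widetilde X$. Let $\operatorname{Shv}_k(X)$ be the category of sheaves of $k$-modules on $X$, let $\operatorname{Mod}_k(G)$ be the category of $k$-modules with a $k$-linear action of $G$, and let $i\colon\operatorname{Qcoh}_k(X)\hookrightarrow\operatorname{Shv}_k(X)$ be the inclusion of the full subcategory of quasi-coherent sheaves, i.e. of those $F$ such that every point has an open neighbourhood $U$ with an exact sequence $k_U^{\oplus I}\to k_U^{\oplus J}\to F|_U\to 0$. For a $G$-module $E$ let $\mathcal L_E$ be the sheaf of sections of $(\widetilde X\times E)/G\to\widetilde X/G=X$, where $E$ is discrete and $G$ acts by $g(\tilde x,e)=(g\tilde x,ge)$, with the fibrewise $k$-module structure $[\tilde x,e]+[\tilde x,e']=[\tilde x,e+e']$, $c[\tilde x,e]=[\tilde x,ce]$. For a sheaf $F$ on $X$, let $G$ act on $\Gamma(\widetilde X,\phi^{-1}F)$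 through its action on $\phi^{-1}F$, i.e. $g\cdot s=s\circ g^{-1}$ for $s$ viewed as a continuous map from $\widetilde X$ to the étalé space of $F$ over $X$. Then every $\mathcal L_E$ is quasi-coherent, in fact locally constant, and $E\mapsto\mathcal L_E$ is an equivalence $\operatorname{Mod}_k(G)\to\operatorname{Qcoh}_k(X)$. The inclusion $i$ has a right adjoint, and for every right adjoint $\operatorname{Qc}\colon\operatorname{Shv}_k(X)\to\operatorname{Qcoh}_k(X)$ of $i$ (the quasi-coherator) there is an isomorphism, natural in $F\in\operatorname{Shv}_k(X)$, $$\operatorname{Qc}(F)\cong\mathcal L_{\Gamma(\widetilde X,\phi^{-1}F)} .$$ -/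

import Mathlib

open CategoryTheory Limits TopologicalSpace Topology Opposite

universe u

namespace QuasiCoherator

section Coverings

/-- A space is *simply connected* if it is connected (in particular non-empty) and every covering
of it is trivial, i.e. isomorphic over the space to a product with a discrete space. -/
structure IsSimplyConnected (X : Type u) [TopologicalSpace X] : Prop where
  connectedSpace : ConnectedSpace X
  exists_trivialization : ∀ (E : Type u) [TopologicalSpace E] (p : E → X), IsCoveringMap p →
    ∃ (I : Type u) (_ : TopologicalSpace I) (_ : DiscreteTopology I),
      IsHomeomorphicTrivialFiberBundle I p

/-- A space is *locally simply connected* if every point has a basis of simply connected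
open neighbourhoods. -/
def IsLocallySimplyConnected (X : Type u) [TopologicalSpace X] : Prop :=
  ∀ (x : X) (U : Set X), U ∈ 𝓝 x →
    ∃ V : Set X, V ⊆ U ∧ IsOpen V ∧ x ∈ V ∧ IsSimplyConnected V

/-- A *universal covering* is a covering map whose total space is simply connected. -/
class IsUniversalCovering {X Y : TopCat.{u}} (φ : Y ⟶ X) : Prop where
  isCoveringMap : IsCoveringMap φ
  isSimplyConnected : IsSimplyConnected Y

/-- The group `Aut_X Y` of automorphisms of `Y` over `X`. -/
def Deck {X Y : TopCat.{u}} (φ : Y ⟶ X) : Subgroup (Y ≃ₜ Y) where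
  carrier := {g | ∀ y, φ (g y) = φ y}
  mul_mem' {a b} ha hb y := (ha (b y)).trans (hb y)
  one_mem' _ := rfl
  inv_mem' {a} ha y := by
    have := ha (a.symm y)
    rw [a.apply_symm_apply] at this
    exact this.symm

/-- The first projection of the fibre product of two copies of a covering is a covering. -/
theorem isCoveringMap_fst {X Y : Type u} [TopologicalSpace X] [TopologicalSpace Y] {p : Y → X}
    (hp : IsCoveringMap p) :
    IsCoveringMap (fun z : {z : Y × Y // p z.1 = p z.2} => z.1.1) := by
  intro y
  obtain ⟨hI, U, hyU, hU, hpU, H, hH⟩ := hp (p y)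
  refine IsEvenlyCovered.to_isEvenlyCovered_preimage (I := p ⁻¹' {p y})
    ⟨hI, p ⁻¹' U, hyU, hpU, hpU.preimage (by fun_prop), ?_⟩
  refine ⟨⟨⟨fun z => (⟨z.1.1.1, z.2⟩, (H ⟨z.1.1.2, by
      have h1 := z.1.2; have h2 := z.2
      simp only [Set.mem_preimage] at h2 ⊢; rwa [← h1]⟩).2),
    fun w => ⟨⟨(w.1.1, (H.symm (⟨p w.1.1, w.1.2⟩, w.2)).1), by
      have := hH (H.symm (⟨p w.1.1, w.1.2⟩, w.2))
      simpa using this⟩, w.1.2⟩, ?_, ?_⟩, ?_, ?_⟩, fun _ => rfl⟩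
  · rintro ⟨⟨⟨a, b⟩, h⟩, ha⟩
    have hb : b ∈ p ⁻¹' U := by
      simp only [Set.mem_preimage] at ha ⊢; rwa [← h]
    have : ((⟨p a, ha⟩ : U), (H ⟨b, hb⟩).2) = H ⟨b, hb⟩ := by
      refine Prod.ext (Subtype.ext ?_) rfl
      rw [hH]; exact h
    simp [this]
  · rintro ⟨⟨a, ha⟩, i⟩
    simp
  · have : Continuous p := hp.continuous
    fun_prop
  · have : Continuous p := hp.continuous
    fun_prop

variable {X Y : TopCat.{u}} (φ : Y ⟶ X)

theorem surjective [ConnectedSpace X] [IsUniversalCovering φ] : Function.Surjective φ := by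
  have hφ : IsCoveringMap φ := IsUniversalCovering.isCoveringMap
  have := (IsUniversalCovering.isSimplyConnected φ).connectedSpace
  have hc : IsClosed (Set.range φ) := by
    rw [← isOpen_compl_iff, isOpen_iff_mem_nhds]
    intro x hx
    obtain ⟨-, U, hxU, hU, -, H, -⟩ := hφ x
    refine Filter.mem_of_superset (hU.mem_nhds hxU) ?_
    rintro _ hyU ⟨y, rfl⟩
    exact hx ⟨_, (H ⟨y, hyU⟩).2.2⟩
  rw [← Set.range_eq_univ]
  exact IsClopen.eq_univ ⟨hc, hφ.isOpenMap.isOpen_range⟩ (Set.range_nonempty _)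

theorem deck_ext [IsUniversalCovering φ] {g h : Deck φ} (y : Y) (hy : g.1 y = h.1 y) : g = h := by
  have := (IsUniversalCovering.isSimplyConnected φ).connectedSpace
  refine Subtype.ext (Homeomorph.ext fun z => congrFun ?_ z)
  refine (IsUniversalCovering.isCoveringMap (φ := φ)).eq_of_comp_eq g.1.continuous h.1.continuous
    (funext fun z => ?_) y hy
  exact (g.2 z).trans (h.2 z).symm

theorem exists_deck [IsUniversalCovering φ] {y z : Y} (h : φ y = φ z) :
    ∃ g : Deck φ, g.1 y = z := by
  have hs := IsUniversalCovering.isSimplyConnected φ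
  have hφ : IsCoveringMap φ := IsUniversalCovering.isCoveringMap
  have := hs.connectedSpace
  obtain ⟨I, _, _, e, he⟩ := hs.exists_trivialization _ _ (isCoveringMap_fst hφ)
  have key : ∀ y z : Y, φ y = φ z → ∃ f : Y → Y, Continuous f ∧ φ ∘ f = φ ∧ f y = z := by
    intro y z h
    refine ⟨fun w => (e.symm (w, (e ⟨(y, z), h⟩).2)).1.2, by fun_prop, ?_, ?_⟩
    · funext w
      have h1 := (e.symm (w, (e ⟨(y, z), h⟩).2)).2
      have h2 := he (e.symm (w, (e ⟨(y, z), h⟩).2))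
      rw [e.apply_symm_apply] at h2
      simp only at h2
      rw [← h2] at h1
      exact h1.symm
    · have : (y, (e ⟨(y, z), h⟩).2) = e ⟨(y, z), h⟩ := Prod.ext (he ⟨(y, z), h⟩).symm rfl
      simp only [this, e.symm_apply_apply]
  obtain ⟨f, hf, hf1, hf2⟩ := key y z h
  obtain ⟨f', hf', hf1', hf2'⟩ := key z y h.symm
  have h1 : f' ∘ f = id := hφ.eq_of_comp_eq (hf'.comp hf) continuous_id
    (by rw [← Function.comp_assoc, hf1', hf1]; rfl) y (by simp [hf2, hf2'])
  have h2 : f ∘ f' = id := hφ.eq_of_comp_eq (hf.comp hf') continuous_id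
    (by rw [← Function.comp_assoc, hf1, hf1']; rfl) z (by simp [hf2, hf2'])
  exact ⟨⟨⟨⟨f, f', congrFun h1, congrFun h2⟩, hf, hf'⟩, congrFun hf1⟩, hf2⟩

end Coverings

section Sheaves

/-- The category `Shv_k(X)` of sheaves of `k`-modules on `X`. -/
abbrev Shv (k : Type u) [Ring k] (X : TopCat.{u}) :=
  Sheaf (Opens.grothendieckTopology X) (ModuleCat.{u} k)

instance hasColimitsOfShape_discrete (k : Type u) [Ring k] (X : TopCat.{u}) (I : Type u) :
    HasColimitsOfShape (Discrete I) (Shv k X) :=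
  Sheaf.instHasColimitsOfShape

/-- The direct sum `k_X^{⊕ I}` of copies of the constant sheaf `k_X`. -/
noncomputable def freeSheaf (k : Type u) [Ring k] (X : TopCat.{u}) (I : Type u) : Shv k X :=
  ∐ fun _ : I => (constantSheaf (Opens.grothendieckTopology X) (ModuleCat.{u} k)).obj
    (ModuleCat.of k k)

/-- The restriction `F|_U` of a sheaf to an open subset. -/
abbrev restrict {k : Type u} [Ring k] {X : TopCat.{u}} (U : Opens X) (F : Shv k X) :
    Shv k (TopCat.of U) :=
  U.sheafRestrict.obj F

/-- A sheaf of `k`-modules is *quasi-coherent* if every point has an open neighbourhood `U`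
with an exact sequence `k_U^{⊕ I} ⟶ k_U^{⊕ J} ⟶ F|_U ⟶ 0` of sheaves on `U`. -/
def IsQuasicoherent (k : Type u) [Ring k] (X : TopCat.{u}) : ObjectProperty (Shv k X) := fun F =>
  ∀ x : X, ∃ U : Opens X, x ∈ U ∧ ∃ (I J : Type u)
    (f : freeSheaf k (TopCat.of U) I ⟶ freeSheaf k (TopCat.of U) J)
    (g : freeSheaf k (TopCat.of U) J ⟶ restrict U F) (w : f ≫ g = 0),
      (ShortComplex.mk f g w).Exact ∧ Epi g

/-- A sheaf of `k`-modules is *locally constant* if every point has an open neighbourhood on which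
the sheaf is isomorphic to a constant sheaf. -/
def IsLocallyConstantSheaf {k : Type u} [Ring k] {X : TopCat.{u}} (F : Shv k X) : Prop :=
  ∀ x : X, ∃ U : Opens X, x ∈ U ∧ ∃ M : ModuleCat.{u} k,
    Nonempty (restrict U F ≅ (constantSheaf (Opens.grothendieckTopology U) (ModuleCat.{u} k)).obj M)

/-- The full subcategory `Qcoh_k(X)` of quasi-coherent sheaves. -/
abbrev Qcoh (k : Type u) [Ring k] (X : TopCat.{u}) := (IsQuasicoherent k X).FullSubcategory

/-- The inclusion functor of the quasi-coherent sheaves into all sheaves. -/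
noncomputable abbrev incl (k : Type u) [Ring k] (X : TopCat.{u}) : Qcoh k X ⥤ Shv k X := (IsQuasicoherent k X).ι

/-- The direct image functor `φ_*`. -/
noncomputable def push {X Y : TopCat.{u}} (φ : Y ⟶ X) (k : Type u) [Ring k] : Shv k Y ⥤ Shv k X :=
  TopCat.Sheaf.pushforward (ModuleCat.{u} k) φ

/-- The inverse image functor `φ⁻¹`. -/
noncomputable def pull {X Y : TopCat.{u}} (φ : Y ⟶ X) (k : Type u) [Ring k] : Shv k X ⥤ Shv k Y :=
  TopCat.Sheaf.pullback (ModuleCat.{u} k) φ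

/-- The adjunction between the inverse image and the direct image. -/
noncomputable def pullPushAdj {X Y : TopCat.{u}} (φ : Y ⟶ X) (k : Type u) [Ring k] :
    pull φ k ⊣ push φ k :=
  TopCat.Sheaf.pullbackPushforwardAdjunction (ModuleCat.{u} k) φ

end Sheaves

section GlobalSections

variable {X Y : TopCat.{u}} (φ : Y ⟶ X) (k : Type u) [Ring k]

/-- An automorphism of `Y` over `X` as a morphism of topological spaces. -/
def deckHom (g : Deck φ) : Y ⟶ Y := TopCat.ofHom ⟨g.1, g.1.continuous⟩

variable {φ} in
theorem preimage_deckHom_le (g : Deck φ) (U : Opens X) :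
    (Opens.map (deckHom φ g)).obj ((Opens.map φ).obj U) ≤ (Opens.map φ).obj U := fun y hy => by
  have h : φ (g.1 y) ∈ U := hy
  rw [g.2 y] at h
  exact h

variable {φ k} in
/-- The identification `Q(φ⁻¹ U) ⟶ Q(g⁻¹ φ⁻¹ U)` coming from `φ ∘ g = φ`. -/
def deckRes (g : Deck φ) (Q : Shv k Y) (U : Opens X) :
    Q.1.obj (op ((Opens.map φ).obj U)) ⟶
      Q.1.obj (op ((Opens.map (deckHom φ g)).obj ((Opens.map φ).obj U))) :=
  Q.1.map (homOfLE (preimage_deckHom_le g U)).op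

variable {φ k} in
/-- The canonical identification `φ_* Q ⟶ φ_* (g_* Q)` coming from `φ ∘ g = φ`. -/
def pushDeck (g : Deck φ) (Q : Shv k Y) :
    (push φ k).obj Q ⟶ (push φ k).obj ((push (deckHom φ g) k).obj Q) :=
  ⟨{ app U := deckRes g Q U.unop
     naturality U V i := by
        change Q.1.map _ ≫ Q.1.map _ = Q.1.map _ ≫ Q.1.map _
        rw [← Q.1.map_comp, ← Q.1.map_comp]
        rfl }⟩

/-- The action of `g` on `φ⁻¹ F`: the morphism `φ⁻¹ F ⟶ g_* φ⁻¹ F` that corresponds, by adjunction,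
to `F ⟶ φ_* φ⁻¹ F = φ_* g_* φ⁻¹ F`. On sections it is the pull-back `s ↦ s ∘ g`. -/
noncomputable def deckPull (g : Deck φ) (F : Shv k X) :
    (pull φ k).obj F ⟶ (push (deckHom φ g) k).obj ((pull φ k).obj F) :=
  ((pullPushAdj φ k).homEquiv _ _).symm ((pullPushAdj φ k).unit.app F ≫ pushDeck g _)

variable {φ k} in
/-- The pull-back `s ↦ s ∘ g` on sections over `V`. -/
noncomputable def deckPullApp (g : Deck φ) (F : Shv k X) (V : Opens Y) :
    ((pull φ k).obj F).1.obj (op V) ⟶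
      ((pull φ k).obj F).1.obj (op ((Opens.map (deckHom φ g)).obj V)) :=
  (deckPull φ k g F).1.app (op V)

variable {φ k} in
/-- The unit `F(U) ⟶ (φ⁻¹ F)(φ⁻¹ U)`. -/
noncomputable def unitApp (F : Shv k X) (U : Opens X) :
    F.1.obj (op U) ⟶ ((pull φ k).obj F).1.obj (op ((Opens.map φ).obj U)) :=
  ((pullPushAdj φ k).unit.app F).1.app (op U)

variable {φ k} in
theorem pullback_hom_ext {F : Shv k X} {Q : Shv k Y} {a b : (pull φ k).obj F ⟶ Q}
    (h : ∀ U : Opens X, unitApp F U ≫ a.1.app (op ((Opens.map φ).obj U)) =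
      unitApp F U ≫ b.1.app (op ((Opens.map φ).obj U))) : a = b := by
  apply ((pullPushAdj φ k).homEquiv _ _).injective
  rw [Adjunction.homEquiv_unit, Adjunction.homEquiv_unit]
  apply CategoryTheory.Sheaf.hom_ext
  apply NatTrans.ext
  funext U
  exact h U.unop

theorem unit_deckPull (g : Deck φ) (F : Shv k X) (U : Opens X) :
    unitApp F U ≫ deckPullApp g F ((Opens.map φ).obj U) =
      unitApp F U ≫ deckRes g ((pull φ k).obj F) U := by
  have h : (pullPushAdj φ k).unit.app F ≫ (push φ k).map (deckPull φ k g F) =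
      (pullPushAdj φ k).unit.app F ≫ pushDeck g _ :=
    ((pullPushAdj φ k).homEquiv_unit ..).symm.trans
      (((pullPushAdj φ k).homEquiv _ _).apply_symm_apply _)
  exact congrArg (fun (f : F ⟶ (push φ k).obj ((push (deckHom φ g) k).obj ((pull φ k).obj F))) =>
    f.1.app (op U)) h

theorem deckPull_one (F : Shv k X) (V : Opens Y) :
    deckPullApp (1 : Deck φ) F V = 𝟙 (((pull φ k).obj F).1.obj (op V)) := by
  have h : deckPull φ k 1 F = 𝟙 ((pull φ k).obj F) := by
    apply pullback_hom_ext
    intro U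
    refine (unit_deckPull φ k 1 F U).trans ?_
    exact congrArg (unitApp F U ≫ ·) (((pull φ k).obj F).1.map_id _)
  exact congrArg (fun (f : (pull φ k).obj F ⟶ (pull φ k).obj F) => f.1.app (op V)) h

theorem deckPull_res (g h : Deck φ) (F : Shv k X) (U : Opens X) :
    deckRes g ((pull φ k).obj F) U ≫ deckPullApp h F _ =
      deckPullApp h F ((Opens.map φ).obj U) ≫
        ((pull φ k).obj F).1.map
          ((Opens.map (deckHom φ h)).map (homOfLE (preimage_deckHom_le g U))).op :=
  (deckPull φ k h F).1.naturality _

theorem deckPull_mul (g h : Deck φ) (F : Shv k X) (V : Opens Y) : deckPullApp (g * h) F V =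
    deckPullApp g F V ≫ deckPullApp h F ((Opens.map (deckHom φ g)).obj V) := by
  have key : deckPull φ k (g * h) F =
      deckPull φ k g F ≫ (push (deckHom φ g) k).map (deckPull φ k h F) := by
    apply pullback_hom_ext
    intro U
    have h1 : unitApp F U ≫ deckPullApp g F ((Opens.map φ).obj U) ≫
        deckPullApp h F ((Opens.map (deckHom φ g)).obj ((Opens.map φ).obj U)) =
        unitApp F U ≫ deckRes (g * h) ((pull φ k).obj F) U := by
      rw [← Category.assoc, unit_deckPull, Category.assoc, deckPull_res, ← Category.assoc,
        unit_deckPull, Category.assoc]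
      exact congrArg (unitApp F U ≫ ·) (((pull φ k).obj F).1.map_comp _ _).symm
    exact (unit_deckPull φ k (g * h) F U).trans h1.symm
  exact congrArg (fun (f : (pull φ k).obj F ⟶ (push (deckHom φ (g * h)) k).obj ((pull φ k).obj F)) =>
    f.1.app (op V)) key

variable {φ k} in
/-- The map induced by `f : F ⟶ F'` on sections of the inverse images. -/
noncomputable def pullApp {F F' : Shv k X} (f : F ⟶ F') (V : Opens Y) :
    ((pull φ k).obj F).1.obj (op V) ⟶ ((pull φ k).obj F').1.obj (op V) :=
  ((pull φ k).map f).1.app (op V)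

theorem unitApp_naturality {F F' : Shv k X} (f : F ⟶ F') (U : Opens X) :
    unitApp F U ≫ pullApp (φ := φ) f ((Opens.map φ).obj U) = f.1.app (op U) ≫ unitApp F' U :=
  (congrArg (fun (f : F ⟶ (push φ k).obj ((pull φ k).obj F')) => f.1.app (op U))
    ((pullPushAdj φ k).unit.naturality f)).symm

theorem pullApp_deckRes (g : Deck φ) {F F' : Shv k X} (f : F ⟶ F') (U : Opens X) :
    deckRes g ((pull φ k).obj F) U ≫ pullApp f _ =
      pullApp f ((Opens.map φ).obj U) ≫ deckRes g ((pull φ k).obj F') U :=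
  ((pull φ k).map f).1.naturality _

theorem deckPull_naturality (g : Deck φ) {F F' : Shv k X} (f : F ⟶ F') (V : Opens Y) :
    pullApp f V ≫ deckPullApp g F' V =
      deckPullApp g F V ≫ pullApp f ((Opens.map (deckHom φ g)).obj V) := by
  have key : (pull φ k).map f ≫ deckPull φ k g F' =
      deckPull φ k g F ≫ (push (deckHom φ g) k).map ((pull φ k).map f) := by
    apply pullback_hom_ext
    intro U
    have h1 : unitApp F U ≫ pullApp f ((Opens.map φ).obj U) ≫
          deckPullApp g F' ((Opens.map φ).obj U) =
        unitApp F U ≫ deckPullApp g F ((Opens.map φ).obj U) ≫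
          pullApp f ((Opens.map (deckHom φ g)).obj ((Opens.map φ).obj U)) := by
      rw [← Category.assoc, ← Category.assoc, unit_deckPull, unitApp_naturality, Category.assoc,
        unit_deckPull, Category.assoc, pullApp_deckRes, ← Category.assoc, ← Category.assoc,
        unitApp_naturality]
    exact h1
  exact congrArg (fun (f : (pull φ k).obj F ⟶ (push (deckHom φ g) k).obj ((pull φ k).obj F')) =>
    f.1.app (op V)) key

/-- The functor `F ↦ Γ(Y, φ⁻¹ F)` from sheaves on `X` to `G`-modules, `G = Aut_X Y`:
the element `g` acts by `s ↦ s ∘ g⁻¹`. -/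
noncomputable def sectionsRep : Shv k X ⥤ Rep.{u} k (Deck φ) where
  obj F := Rep.of (X := ((pull φ k).obj F).1.obj (op ⊤))
    { toFun g := (deckPullApp g⁻¹ F ⊤).hom
      map_one' := by
        rw [inv_one]
        exact congrArg ModuleCat.Hom.hom (deckPull_one φ k F ⊤)
      map_mul' g h := by
        rw [mul_inv_rev]
        exact congrArg ModuleCat.Hom.hom (deckPull_mul φ k h⁻¹ g⁻¹ F ⊤) }
  map {F F'} f := Rep.ofHom ⟨(pullApp f ⊤).hom, fun g =>
    (congrArg ModuleCat.Hom.hom (deckPull_naturality φ k g⁻¹ f ⊤)).symm⟩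
  map_id F := by
    apply Rep.hom_ext
    apply Representation.IntertwiningMap.ext
    exact congrArg (fun (a : (pull φ k).obj F ⟶ (pull φ k).obj F) => (a.1.app (op ⊤)).hom)
      ((pull φ k).map_id F)
  map_comp {F F' F''} f g := by
    apply Rep.hom_ext
    apply Representation.IntertwiningMap.ext
    exact congrArg (fun (a : (pull φ k).obj F ⟶ (pull φ k).obj F'') => (a.1.app (op ⊤)).hom)
      ((pull φ k).map_comp f g)

end GlobalSections

section AssociatedSheaf

variable {X Y : TopCat.{u}} (φ : Y ⟶ X) {k : Type u} [Ring k] (E : Rep.{u} k (Deck φ))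

/-- The orbit relation of the diagonal action `g (y, e) = (g y, g e)` on `Y × E`. -/
def orbitSetoid : Setoid (Y × E) where
  r a b := ∃ g : Deck φ, g.1 a.1 = b.1 ∧ E.ρ g a.2 = b.2
  iseqv :=
    { refl a := ⟨1, rfl, by rw [map_one]; rfl⟩
      symm := by
        rintro ⟨y, e⟩ ⟨_, _⟩ ⟨g, rfl, rfl⟩
        exact ⟨g⁻¹, g.1.symm_apply_apply y, by
          rw [← Module.End.mul_apply, ← map_mul, inv_mul_cancel, map_one]; rfl⟩
      trans := by
        rintro ⟨y, e⟩ ⟨_, _⟩ ⟨_, _⟩ ⟨g, rfl, rfl⟩ ⟨h, rfl, rfl⟩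
        exact ⟨h * g, rfl, by rw [map_mul]; rfl⟩ }

/-- The quotient `(Y × E) / G` by the diagonal action of `G = Aut_X Y`. -/
def AssocSpace : Type u := Quotient (orbitSetoid φ E)

/-- The class of `(y, e)` in `(Y × E) / G`. -/
def AssocSpace.mk (y : Y) (e : E) : AssocSpace φ E := Quotient.mk (orbitSetoid φ E) (y, e)

/-- The quotient topology, `E` being discrete. -/
instance : TopologicalSpace (AssocSpace φ E) :=
  letI : TopologicalSpace E := ⊥
  inferInstanceAs (TopologicalSpace (Quotient (orbitSetoid φ E)))

/-- The projection `(Y × E) / G ⟶ Y / G = X` induced by `φ`. -/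
def AssocSpace.proj : AssocSpace φ E → X :=
  Quotient.lift (fun a => φ a.1) (by
    rintro ⟨y, e⟩ ⟨_, _⟩ ⟨g, rfl, rfl⟩
    exact (g.2 y).symm)

namespace AssocSpace

variable {φ E}

theorem continuous_mk (e : E) : Continuous fun y => AssocSpace.mk φ E y e := by
  let _ : TopologicalSpace E := ⊥
  exact continuous_quotient_mk'.comp (Continuous.prodMk continuous_id continuous_const)

theorem mk_eq_mk {y z : Y} {e f : E} :
    AssocSpace.mk φ E y e = AssocSpace.mk φ E z f ↔ ∃ g : Deck φ, g.1 y = z ∧ E.ρ g e = f :=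
  Quotient.eq (r := orbitSetoid φ E)

theorem isOpen_image {V : Set Y} (hV : IsOpen V) (e : E) :
    IsOpen ((fun y => AssocSpace.mk φ E y e) '' V) := by
  let _ : TopologicalSpace E := ⊥
  have : DiscreteTopology E := ⟨rfl⟩
  refine isOpen_coinduced.2 ?_
  have : (Quotient.mk (orbitSetoid φ E)) ⁻¹' ((fun y => AssocSpace.mk φ E y e) '' V) =
      ⋃ g : Deck φ, (g.1 '' V) ×ˢ {E.ρ g e} := by
    ext ⟨z, f⟩
    simp only [Set.mem_preimage, Set.mem_image, Set.mem_iUnion, Set.mem_prod,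
      Set.mem_singleton_iff]
    constructor
    · rintro ⟨y, hy, h⟩
      obtain ⟨g, h1, h2⟩ := mk_eq_mk.1 h
      exact ⟨g, ⟨y, hy, h1⟩, h2.symm⟩
    · rintro ⟨g, ⟨y, hy, h1⟩, h2⟩
      exact ⟨y, hy, mk_eq_mk.2 ⟨g, h1, h2.symm⟩⟩
  exact this ▸ isOpen_iUnion fun g => (g.1.isOpenMap V hV).prod (isOpen_discrete _)

theorem mk_injective [IsUniversalCovering φ] (y : Y) :
    Function.Injective (AssocSpace.mk φ E y) := by
  intro e f h
  obtain ⟨g, h1, h2⟩ := mk_eq_mk.1 h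
  obtain rfl : g = 1 := deck_ext φ y h1
  rw [← h2, map_one]; rfl

theorem exists_mk [IsUniversalCovering φ] (a : AssocSpace φ E) (y : Y)
    (h : AssocSpace.proj φ E a = φ y) : ∃ e : E, AssocSpace.mk φ E y e = a := by
  induction a using Quotient.inductionOn with
  | h a =>
    obtain ⟨z, e⟩ := a
    obtain ⟨g, hg⟩ := exists_deck φ (y := z) (z := y) h
    exact ⟨E.ρ g e, (mk_eq_mk.2 ⟨g, hg, rfl⟩).symm⟩

end AssocSpace

/-- The fibre of `(Y × E) / G ⟶ X` over `x`. -/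
def Fibre (x : X) : Type u := {a : AssocSpace φ E // AssocSpace.proj φ E a = x}

variable {φ E} in
/-- An element of the fibre as a point of `(Y × E) / G`. -/
def Fibre.val {x : X} (a : Fibre φ E x) : AssocSpace φ E := Subtype.val a

variable {φ E} in
theorem Fibre.proj_val {x : X} (a : Fibre φ E x) : AssocSpace.proj φ E a.val = x := Subtype.prop a

variable {φ E} in
theorem Fibre.ext {x : X} {a b : Fibre φ E x} (h : a.val = b.val) : a = b := Subtype.ext h

variable {φ E} in
/-- The class of `(y, e)` as an element of the fibre over `φ y = x`. -/
def Fibre.mk {x : X} (y : Y) (hy : φ y = x) (e : E) : Fibre φ E x := ⟨AssocSpace.mk φ E y e, hy⟩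

section

variable [IsUniversalCovering φ]

theorem Fibre.mk_bijective {x : X} (y : Y) (hy : φ y = x) :
    Function.Bijective (Fibre.mk (E := E) y hy) := by
  refine ⟨fun e f h => AssocSpace.mk_injective y (congrArg Fibre.val h), fun a => ?_⟩
  obtain ⟨e, he⟩ := AssocSpace.exists_mk a.val y (a.proj_val.trans hy.symm)
  exact ⟨e, Fibre.ext he⟩

/-- A point `y` over `x` identifies `E` with the fibre over `x`, through `e ↦ [y, e]`. -/
noncomputable def Fibre.equiv {x : X} (y : Y) (hy : φ y = x) : Fibre φ E x ≃ E :=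
  (Equiv.ofBijective _ (Fibre.mk_bijective φ E y hy)).symm

variable [ConnectedSpace X]

noncomputable instance (x : X) : AddCommGroup (Fibre φ E x) :=
  (Fibre.equiv φ E (surjective φ x).choose (surjective φ x).choose_spec).addCommGroup

/-- The `k`-module structure on the fibre over `x`, transported from `E` along `e ↦ [y, e]`
for a point `y` over `x`; it does not depend on `y`, see `Fibre.mk_add` and `Fibre.mk_smul`. -/
noncomputable instance (x : X) : Module k (Fibre φ E x) :=
  (Fibre.equiv φ E (surjective φ x).choose (surjective φ x).choose_spec).module k

variable {φ E} in
/-- The bijection `e ↦ [y, e]` is `k`-linear for every `y` over `x`. -/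
theorem Fibre.exists_linearEquiv {x : X} (y : Y) (hy : φ y = x) :
    ∃ l : E ≃ₗ[k] Fibre φ E x, ∀ e, l e = Fibre.mk y hy e := by
  let y₀ := (surjective φ x).choose
  have hy₀ : φ y₀ = x := (surjective φ x).choose_spec
  let l₀ : Fibre φ E x ≃ₗ[k] E := (Fibre.equiv φ E y₀ hy₀).linearEquiv k
  obtain ⟨g, hg⟩ := exists_deck φ (hy.trans hy₀.symm)
  refine ⟨(LinearEquiv.ofBijective (E.ρ g) ⟨?_, ?_⟩).trans l₀.symm, fun e => ?_⟩
  · exact Function.LeftInverse.injective (g := E.ρ g⁻¹) fun e => by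
      rw [← Module.End.mul_apply, ← map_mul, inv_mul_cancel, map_one]; rfl
  · exact Function.RightInverse.surjective (g := E.ρ g⁻¹) fun e => by
      rw [← Module.End.mul_apply, ← map_mul, mul_inv_cancel, map_one]; rfl
  · refine Fibre.ext ?_
    exact (AssocSpace.mk_eq_mk.2 ⟨g, hg, rfl⟩).symm

variable {φ E}

theorem Fibre.mk_add {x : X} (y : Y) (hy : φ y = x) (e f : E) :
    Fibre.mk y hy (e + f) = Fibre.mk y hy e + Fibre.mk (E := E) y hy f := by
  obtain ⟨l, hl⟩ := Fibre.exists_linearEquiv (E := E) y hy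
  rw [← hl, ← hl, ← hl, map_add]

theorem Fibre.mk_smul {x : X} (y : Y) (hy : φ y = x) (c : k) (e : E) :
    Fibre.mk y hy (c • e) = c • Fibre.mk (E := E) y hy e := by
  obtain ⟨l, hl⟩ := Fibre.exists_linearEquiv (E := E) y hy
  rw [← hl, ← hl, map_smul]

theorem Fibre.mk_zero {x : X} (y : Y) (hy : φ y = x) :
    Fibre.mk y hy 0 = (0 : Fibre φ E x) := by
  obtain ⟨l, hl⟩ := Fibre.exists_linearEquiv (E := E) y hy
  rw [← hl, map_zero]

/-- A family of elements of the fibres is continuous at `x = φ y` exactly if it is of the form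
`φ z ↦ [z, e]`, with `e` fixed, for all `z` near `y`. -/
theorem continuousAt_iff (U : Opens X) (s : ∀ x : U, Fibre φ E x) (y : Y) (hy : φ y ∈ U) (e : E)
    (he : s ⟨φ y, hy⟩ = Fibre.mk y rfl e) :
    ContinuousAt (fun x => (s x).val) ⟨φ y, hy⟩ ↔
      ∀ᶠ z in 𝓝 y, ∀ hz : φ z ∈ U, s ⟨φ z, hz⟩ = Fibre.mk z rfl e := by
  have hφ : IsCoveringMap φ := IsUniversalCovering.isCoveringMap
  obtain ⟨V, hVy, hVi⟩ : ∃ V ∈ 𝓝 y, Set.InjOn φ V := by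
    obtain ⟨f, hf, hf'⟩ := hφ.isLocalHomeomorph y
    exact ⟨f.source, f.open_source.mem_nhds hf, hf' ▸ f.injOn⟩
  obtain ⟨V', hV'V, hV', hyV'⟩ := mem_nhds_iff.1 hVy
  constructor
  · intro h
    have h1 := h ((AssocSpace.isOpen_image (E := E) hV' e).mem_nhds ⟨y, hyV', by
      exact (congrArg Fibre.val he).symm⟩)
    have h2 : ContinuousAt φ y := hφ.continuous.continuousAt
    have h3 : ∀ᶠ x in 𝓝 (φ y), ∀ hx : x ∈ U, (s ⟨x, hx⟩).val ∈
        (fun y => AssocSpace.mk φ E y e) '' V' := by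
      have := (U.isOpenEmbedding'.map_nhds_eq ⟨φ y, hy⟩)
      change ∀ᶠ x in 𝓝 ((⟨φ y, hy⟩ : U) : X), _
      rw [← this, Filter.eventually_map]
      filter_upwards [h1] with x hx _
      exact hx
    filter_upwards [h2.eventually h3, hV'.mem_nhds hyV'] with z hz hzV hzU
    obtain ⟨w, hw, hwz⟩ := hz hzU
    have : φ w = φ z := (congrArg (AssocSpace.proj φ E) hwz).trans (s ⟨φ z, hzU⟩).proj_val
    obtain rfl := hVi (hV'V hw) (hV'V hzV) this
    exact Fibre.ext hwz.symm
  · intro h W hW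
    have hW' : ∀ᶠ z in 𝓝 y, AssocSpace.mk φ E z e ∈ W :=
      (AssocSpace.continuous_mk e).continuousAt (by
        change W ∈ 𝓝 (s ⟨φ y, hy⟩).val at hW
        rwa [he] at hW)
    have h4 : ∀ᶠ x in 𝓝 (φ y), ∀ hx : x ∈ U, (s ⟨x, hx⟩).val ∈ W := by
      rw [← hφ.isLocalHomeomorph.map_nhds_eq, Filter.eventually_map]
      filter_upwards [h, hW'] with z hz hzW hzU
      rw [hz hzU]
      exact hzW
    have h5 := (continuous_subtype_val.continuousAt (x := (⟨φ y, hy⟩ : U))).eventually h4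
    exact h5.mono fun x hx => hx x.2

theorem continuous_iff (U : Opens X) (s : ∀ x : U, Fibre φ E x) :
    Continuous (fun x => (s x).val) ↔ ∀ (y : Y) (hy : φ y ∈ U),
      ∃ e : E, ∀ᶠ z in 𝓝 y, ∀ hz : φ z ∈ U, s ⟨φ z, hz⟩ = Fibre.mk z rfl e := by
  constructor
  · intro h y hy
    obtain ⟨e, he⟩ := (Fibre.mk_bijective φ E y rfl).2 (s ⟨φ y, hy⟩)
    exact ⟨e, (continuousAt_iff U s y hy e he.symm).1 h.continuousAt⟩
  · intro h
    rw [continuous_iff_continuousAt]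
    rintro ⟨x, hx⟩
    obtain ⟨y, rfl⟩ := surjective φ x
    obtain ⟨e, he⟩ := h y hx
    exact (continuousAt_iff U s y hx e (he.self_of_nhds hx)).2 he

variable (φ E)

/-- The `k`-module of continuous sections of `(Y × E) / G ⟶ X` over `U`, with the fibrewise
operations. -/
noncomputable def assocSections (U : Opens X) : Submodule k (∀ x : U, Fibre φ E x) where
  carrier := {s | Continuous fun x => (s x).val}
  add_mem' {s t} hs ht := (continuous_iff U _).2 fun y hy => by
    obtain ⟨e, he⟩ := (continuous_iff U s).1 hs y hy
    obtain ⟨f, hf⟩ := (continuous_iff U t).1 ht y hy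
    refine ⟨e + f, ?_⟩
    filter_upwards [he, hf] with z hz hz' hzU
    rw [Fibre.mk_add, ← hz hzU, ← hz' hzU]; rfl
  zero_mem' := (continuous_iff U _).2 fun _ _ => ⟨0, Filter.Eventually.of_forall fun z hz => by
    rw [Fibre.mk_zero]; rfl⟩
  smul_mem' c s hs := (continuous_iff U _).2 fun y hy => by
    obtain ⟨e, he⟩ := (continuous_iff U s).1 hs y hy
    refine ⟨c • e, ?_⟩
    filter_upwards [he] with z hz hzU
    rw [Fibre.mk_smul, ← hz hzU]; rfl

/-- The presheaf of sections of `(Y × E) / G ⟶ X`. -/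
noncomputable def assocPresheaf : (Opens X)ᵒᵖ ⥤ ModuleCat.{u} k where
  obj U := ModuleCat.of k (assocSections φ E U.unop)
  map {U V} i := ModuleCat.ofHom
    { toFun s := ⟨fun x => s.1 ⟨x.1, i.unop.le x.2⟩,
        s.2.comp (continuous_subtype_val.subtype_mk fun x => i.unop.le x.2)⟩
      map_add' _ _ := rfl
      map_smul' _ _ := rfl }

/-- Continuity of a family of elements of the fibres is a local condition. -/
def continuousSection : TopCat.LocalPredicate (Fibre φ E) where
  pred {U} s := Continuous fun x => (s x).val
  res {U V} i s hs := hs.comp (continuous_subtype_val.subtype_mk fun x => i.le x.2)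
  locality {U} s h := by
    rw [continuous_iff_continuousAt]
    intro x
    obtain ⟨V, hxV, i, hV⟩ := h x
    exact ((Opens.isOpenEmbedding_of_le i.le).continuousAt_iff (x := (⟨x.1, hxV⟩ : V))).1
      hV.continuousAt

theorem assocPresheaf_isSheaf :
    Presheaf.IsSheaf (Opens.grothendieckTopology X) (assocPresheaf φ E) :=
  (TopCat.Presheaf.isSheaf_iff_isSheaf_comp (forget (ModuleCat.{u} k)) (X := X)
    (assocPresheaf φ E)).2
    (TopCat.subpresheafToTypes.isSheaf (continuousSection φ E))

/-- The sheaf `𝓛_E` of sections of `(Y × E) / G ⟶ X`. -/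
noncomputable def assocSheaf : Shv k X := ⟨assocPresheaf φ E, assocPresheaf_isSheaf φ E⟩

end

section Functoriality

variable {φ} {E} {E' E'' : Rep.{u} k (Deck φ)}

/-- The map `[y, e] ↦ [y, f e]` induced by a morphism of `G`-modules. -/
def AssocSpace.map (f : E ⟶ E') : AssocSpace φ E → AssocSpace φ E' :=
  Quotient.map (fun a => (a.1, f.hom a.2)) (by
    rintro ⟨y, e⟩ ⟨_, _⟩ ⟨g, rfl, rfl⟩
    exact ⟨g, rfl, (Rep.hom_comm_apply f g e).symm⟩)

/-- The map induced by a morphism of `G`-modules on the fibres. -/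
def Fibre.map (f : E ⟶ E') {x : X} (a : Fibre φ E x) : Fibre φ E' x :=
  ⟨AssocSpace.map f a.val, by
    obtain ⟨a, rfl⟩ := a
    induction a using Quotient.inductionOn with
    | h a => rfl⟩

theorem Fibre.map_mk (f : E ⟶ E') {x : X} (y : Y) (hy : φ y = x) (e : E) :
    Fibre.map f (Fibre.mk y hy e) = Fibre.mk y hy (f.hom e) := rfl

theorem Fibre.map_id {x : X} (a : Fibre φ E x) : Fibre.map (𝟙 E) a = a := by
  obtain ⟨a, rfl⟩ := a
  induction a using Quotient.inductionOn with
  | h a => rfl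

theorem Fibre.map_comp (f : E ⟶ E') (g : E' ⟶ E'') {x : X} (a : Fibre φ E x) :
    Fibre.map (f ≫ g) a = Fibre.map g (Fibre.map f a) := by
  obtain ⟨a, rfl⟩ := a
  induction a using Quotient.inductionOn with
  | h a => rfl

variable [IsUniversalCovering φ] [ConnectedSpace X]

/-- The map induced by a morphism of `G`-modules on the sections over `U`. -/
noncomputable def assocSectionsMap (f : E ⟶ E') (U : Opens X) :
    assocSections φ E U →ₗ[k] assocSections φ E' U where
  toFun s := ⟨fun x => Fibre.map f (s.1 x), (continuous_iff U _).2 fun y hy => by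
    obtain ⟨e, he⟩ := (continuous_iff U s.1).1 s.2 y hy
    refine ⟨f.hom e, ?_⟩
    filter_upwards [he] with z hz hzU
    rw [hz hzU, Fibre.map_mk]⟩
  map_add' s t := by
    refine Subtype.ext (funext fun x => ?_)
    obtain ⟨y, hy⟩ := surjective φ x.1
    obtain ⟨e, he⟩ := (Fibre.mk_bijective φ E y hy).2 (s.1 x)
    obtain ⟨e', he'⟩ := (Fibre.mk_bijective φ E y hy).2 (t.1 x)
    change Fibre.map f (s.1 x + t.1 x) = Fibre.map f (s.1 x) + Fibre.map f (t.1 x)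
    rw [← he, ← he', ← Fibre.mk_add, Fibre.map_mk, Fibre.map_mk, Fibre.map_mk, ← Fibre.mk_add,
      map_add]
  map_smul' c s := by
    refine Subtype.ext (funext fun x => ?_)
    obtain ⟨y, hy⟩ := surjective φ x.1
    obtain ⟨e, he⟩ := (Fibre.mk_bijective φ E y hy).2 (s.1 x)
    change Fibre.map f (c • s.1 x) = c • Fibre.map f (s.1 x)
    rw [← he, ← Fibre.mk_smul, Fibre.map_mk, Fibre.map_mk, ← Fibre.mk_smul, map_smul]

end Functoriality

/-- The functor `E ↦ 𝓛_E` from `G`-modules to sheaves on `X`. -/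
noncomputable def assocFunctor (k : Type u) [Ring k] [IsUniversalCovering φ] [ConnectedSpace X] :
    Rep.{u} k (Deck φ) ⥤ Shv k X where
  obj E := assocSheaf φ E
  map f := ⟨{ app U := ModuleCat.ofHom (assocSectionsMap f U.unop)
              naturality _ _ _ := rfl }⟩
  map_id E := by
    apply Sheaf.hom_ext
    apply NatTrans.ext
    funext U
    apply ModuleCat.hom_ext
    apply LinearMap.ext
    intro s
    exact Subtype.ext (funext fun x => Fibre.map_id _)
  map_comp f g := by
    apply Sheaf.hom_ext
    apply NatTrans.ext
    funext U
    apply ModuleCat.hom_ext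
    apply LinearMap.ext
    intro s
    exact Subtype.ext (funext fun x => Fibre.map_comp f g _)

end AssociatedSheaf

end QuasiCoherator

/-!
A local section of `φ⁻¹ F` at `y` is the germ of a section of `F` at `φ y`, so a global section of
`φ⁻¹ F` is a continuous family of values in the stalks of `F`, while the stalk of `𝓛_E` at `φ y` is
identified with `E` by `e ↦ [y, e]`. In these terms `E ↦ 𝓛_E` is left adjoint to
`F ↦ Γ(Y, φ⁻¹ F)`: the unit sends `e` to the section with value `[y, e]` at `y`, and the counit
sends `[y, s]` to the value of `s` at `y`. As `Y` is connected, the unit is an isomorphism.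

A quasi-coherent sheaf is locally the cokernel of a morphism of constant sheaves, hence constant on
small connected open sets. The étalé space of its pullback to `Y` is therefore a covering of the
simply connected space `Y`, hence trivial, so that every germ extends uniquely to a global section.
Thus the counit is an isomorphism at every quasi-coherent sheaf, `E ↦ 𝓛_E` is an equivalence onto
the quasi-coherent sheaves, and composing it with `F ↦ Γ(Y, φ⁻¹ F)` gives the quasi-coherator.
-/

namespace QuasiCoherator

section Stalks

variable {k : Type u} [Ring k] {X : TopCat.{u}} {F F' : Shv k X} {U V : Opens X} {x : X}

/-- The stalk of a sheaf of `k`-modules. -/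
noncomputable abbrev Stalk (F : Shv k X) (x : X) : ModuleCat.{u} k :=
  TopCat.Presheaf.stalk (C := ModuleCat.{u} k) F.1 x

/-- The germ of a section, as a linear map. -/
noncomputable def germ (F : Shv k X) (U : Opens X) (x : X) (hx : x ∈ U) :
    F.1.obj (op U) →ₗ[k] Stalk F x :=
  (TopCat.Presheaf.germ (C := ModuleCat.{u} k) F.1 U x hx).hom

/-- The restriction of sections, as a linear map. -/
def res (F : Shv k X) (h : V ≤ U) : F.1.obj (op U) →ₗ[k] F.1.obj (op V) :=
  (F.1.map (homOfLE h).op).hom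

/-- A morphism of sheaves on sections over `U`, as a linear map. -/
def app (f : F ⟶ F') (U : Opens X) : F.1.obj (op U) →ₗ[k] F'.1.obj (op U) :=
  (f.1.app (op U)).hom

/-- The map induced on stalks by a morphism of sheaves, as a linear map. -/
noncomputable def stalkMap (f : F ⟶ F') (x : X) : Stalk F x →ₗ[k] Stalk F' x :=
  ((TopCat.Presheaf.stalkFunctor (ModuleCat.{u} k) x).map f.1).hom

theorem germ_res (h : V ≤ U) (hx : x ∈ V) (s : F.1.obj (op U)) :
    germ F V x hx (res F h s) = germ F U x (h hx) s :=
  TopCat.Presheaf.germ_res_apply F.1 (homOfLE h) x hx s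

theorem stalkMap_germ (f : F ⟶ F') (hx : x ∈ U) (s : F.1.obj (op U)) :
    stalkMap f x (germ F U x hx s) = germ F' U x hx (app f U s) :=
  TopCat.Presheaf.stalkFunctor_map_germ_apply U x hx f.1 s

theorem stalkMap_id (x : X) (a : Stalk F x) : stalkMap (𝟙 F) x a = a :=
  congrArg (fun b => b.hom a) ((TopCat.Presheaf.stalkFunctor (ModuleCat.{u} k) x).map_id F.1)

theorem stalkMap_comp {F'' : Shv k X} (f : F ⟶ F') (g : F' ⟶ F'') (x : X) (a : Stalk F x) :
    stalkMap (f ≫ g) x a = stalkMap g x (stalkMap f x a) :=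
  congrArg (fun b => b.hom a) ((TopCat.Presheaf.stalkFunctor (ModuleCat.{u} k) x).map_comp f.1 g.1)

theorem exists_germ (a : Stalk F x) :
    ∃ (U : Opens X) (hx : x ∈ U) (s : F.1.obj (op U)), germ F U x hx s = a :=
  TopCat.Presheaf.exists_germ_eq F.1 a

theorem eventually_germ_eq {hU : x ∈ U} {hV : x ∈ V} {s : F.1.obj (op U)} {t : F.1.obj (op V)}
    (h : germ F U x hU s = germ F V x hV t) :
    ∀ᶠ z in 𝓝 x, ∃ (hzU : z ∈ U) (hzV : z ∈ V), germ F U z hzU s = germ F V z hzV t := by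
  obtain ⟨W, hxW, iU, iV, hst⟩ := TopCat.Presheaf.germ_eq F.1 x hU hV s t h
  filter_upwards [W.isOpen.mem_nhds hxW] with z hz
  refine ⟨iU.le hz, iV.le hz, ?_⟩
  rw [← germ_res iU.le hz, ← germ_res iV.le hz]
  exact congrArg (germ F W z hz) hst

theorem section_ext {s t : F.1.obj (op U)}
    (h : ∀ (x : X) (hx : x ∈ U), germ F U x hx s = germ F U x hx t) : s = t :=
  TopCat.Presheaf.section_ext F U s t h

theorem exists_section (a : ∀ x ∈ U, Stalk F x)
    (h : ∀ x ∈ U, ∃ (V : Opens X) (s : F.1.obj (op V)),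
      ∀ᶠ z in 𝓝 x, ∃ hzV : z ∈ V, ∀ hzU : z ∈ U, germ F V z hzV s = a z hzU) :
    ∃ s : F.1.obj (op U), ∀ x hx, germ F U x hx s = a x hx := by
  have h' (x : U) : ∃ (W : Opens X) (_ : W ≤ U) (_ : x.1 ∈ W) (s : F.1.obj (op W)),
      ∀ z (hzW : z ∈ W) (hzU : z ∈ U), germ F W z hzW s = a z hzU := by
    obtain ⟨V, s, hs⟩ := h x x.2
    obtain ⟨W, hWs, hW, hxW⟩ := eventually_nhds_iff.1 hs
    let W' : Opens X := ⟨W, hW⟩ ⊓ U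
    have hW'V : W' ≤ V := fun z hz => (hWs z hz.1).1
    exact ⟨W', inf_le_right, ⟨hxW, x.2⟩, res F hW'V s,
      fun z hzW hzU => (germ_res hW'V hzW s).trans ((hWs z hzW.1).2 hzU)⟩
  choose W hWU hxW s hs using h'
  obtain ⟨t, ht, -⟩ := TopCat.Sheaf.existsUnique_gluing' F W U (fun x => homOfLE (hWU x))
    (fun x hx => Opens.mem_iSup.2 ⟨⟨x, hx⟩, hxW _⟩) s fun x y => section_ext fun z hz =>
      (germ_res inf_le_left hz (s x)).trans <| (hs x z hz.1 (hWU x hz.1)).trans <|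
        (hs y z hz.2 (hWU x hz.1)).symm.trans (germ_res inf_le_right hz (s y)).symm
  refine ⟨t, fun x hx => ?_⟩
  rw [← hs ⟨x, hx⟩ x (hxW _) hx, ← germ_res (hWU ⟨x, hx⟩) (hxW _)]
  exact congrArg _ (ht ⟨x, hx⟩)

theorem hom_ext_stalkMap {f g : F ⟶ F'} (h : ∀ x, stalkMap f x = stalkMap g x) : f = g := by
  refine Sheaf.hom_ext (NatTrans.ext (funext fun U => ModuleCat.hom_ext (LinearMap.ext fun s =>
    section_ext fun x hx => ?_)))
  exact (stalkMap_germ f hx s).symm.trans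
    ((LinearMap.congr_fun (h x) _).trans (stalkMap_germ g hx s))

theorem exists_hom (a : ∀ x, Stalk F x →ₗ[k] Stalk F' x)
    (h : ∀ (U : Opens X) (s : F.1.obj (op U)), ∃ t : F'.1.obj (op U),
      ∀ x hx, germ F' U x hx t = a x (germ F U x hx s)) :
    ∃ f : F ⟶ F', ∀ x, stalkMap f x = a x := by
  choose b hb using h
  let f : F ⟶ F' := ⟨{
    app U := ModuleCat.ofHom
      { toFun := b U.unop
        map_add' s t := section_ext fun x hx => by simp only [hb, map_add]
        map_smul' c s := section_ext fun x hx => by simp only [hb, map_smul, RingHom.id_apply] }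
    naturality U V i := ModuleCat.hom_ext <| LinearMap.ext fun s => section_ext fun x hx => by
      refine (hb V.unop _ x hx).trans (Eq.trans ?_ (germ_res i.unop.le hx (b U.unop s)).symm)
      exact (congrArg (a x) (germ_res i.unop.le hx s)).trans (hb ..).symm }⟩
  refine ⟨f, fun x => LinearMap.ext fun c => ?_⟩
  obtain ⟨U, hx, s, rfl⟩ := exists_germ c
  exact (stalkMap_germ f hx s).trans (hb U s x hx)

theorem isIso_iff_stalkMap_bijective (f : F ⟶ F') :
    IsIso f ↔ ∀ x, Function.Bijective (stalkMap f x) := by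
  have hf (x : X) := ConcreteCategory.isIso_iff_bijective
    ((TopCat.Presheaf.stalkFunctor (ModuleCat.{u} k) x).map f.1)
  exact (TopCat.Presheaf.isIso_iff_stalkFunctor_map_iso f).trans (forall_congr' hf)

end Stalks

section InverseImage

variable {X Y : TopCat.{u}} (φ : Y ⟶ X) {k : Type u} [Ring k]

/-- The inverse image of `F` as a presheaf; its sheafification is `φ⁻¹ F`. -/
noncomputable abbrev presheafPull (F : Shv k X) : TopCat.Presheaf (ModuleCat.{u} k) Y :=
  (TopCat.Presheaf.pullback (ModuleCat.{u} k) φ).obj F.1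

/-- The identification of `φ⁻¹ F` with the sheafification of the presheaf inverse image. -/
noncomputable def sheafifyPullIso (F : Shv k X) :
    (presheafToSheaf (Opens.grothendieckTopology Y) (ModuleCat.{u} k)).obj (presheafPull φ F) ≅
      (pull φ k).obj F :=
  ((TopCat.Sheaf.pullbackIso (ModuleCat.{u} k) φ).app F).symm

/-- The sheafification map from the presheaf inverse image to `φ⁻¹ F`. -/
noncomputable def toPull (F : Shv k X) : presheafPull φ F ⟶ ((pull φ k).obj F).1 :=
  toSheafify (Opens.grothendieckTopology Y) (presheafPull φ F) ≫ (sheafifyPullIso φ F).hom.1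

theorem presheafUnit_toPull (F : Shv k X) (U : Opens X) :
    ((TopCat.Presheaf.pullbackPushforwardAdjunction _ φ).unit.app F.1).app (op U) ≫
      (toPull φ F).app (op ((Opens.map φ).obj U)) = unitApp F U := by
  have h := Adjunction.unit_leftAdjointUniq_hom_app
    (Functor.sheafPullbackConstruction.sheafAdjunctionContinuous (Opens.map φ)
      (ModuleCat.{u} k) (Opens.grothendieckTopology X) (Opens.grothendieckTopology Y))
    (pullPushAdj φ k) F
  refine Eq.trans ?_ (congrArg (fun f => f.1.app (op U)) h)
  simp only [toPull, Functor.sheafPullbackConstruction.sheafAdjunctionContinuous]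
  rfl

instance isIso_stalkFunctor_map_toPull (F : Shv k X) (y : Y) :
    IsIso ((TopCat.Presheaf.stalkFunctor (ModuleCat.{u} k) y).map (toPull φ F)) := by
  have := TopCat.Presheaf.stalkFunctor_map_unit_toSheafify_isIso y _ (presheafPull φ F)
  have : IsIso (sheafifyPullIso φ F).hom.1 :=
    inferInstanceAs (IsIso ((sheafToPresheaf _ _).map (sheafifyPullIso φ F).hom))
  rw [toPull, Functor.map_comp]
  infer_instance

/-- The identification `F_x ≅ (φ⁻¹ F)_y` of stalks, for `φ y = x`. -/
noncomputable def stalkEquiv (F : Shv k X) (y : Y) {x : X} (h : φ y = x) :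
    Stalk F x ≃ₗ[k] Stalk ((pull φ k).obj F) y := by
  subst h
  exact (TopCat.Presheaf.stalkPullbackIso (ModuleCat.{u} k) φ F.1 y).toLinearEquiv ≪≫ₗ
    (asIso ((TopCat.Presheaf.stalkFunctor (ModuleCat.{u} k) y).map (toPull φ F))).toLinearEquiv

theorem stalkEquiv_germ (F : Shv k X) {y : Y} {x : X} (h : φ y = x) {U : Opens X} (hx : x ∈ U)
    (hy : y ∈ (Opens.map φ).obj U) (s : F.1.obj (op U)) :
    stalkEquiv φ F y h (germ F U x hx s) =
      germ ((pull φ k).obj F) ((Opens.map φ).obj U) y hy ((unitApp F U).hom s) := by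
  subst h
  have hs := congrArg (fun a => a.hom s)
    (TopCat.Presheaf.germ_stalkPullbackHom (ModuleCat.{u} k) φ F.1 y U hy)
  refine (congrArg _ hs).trans ((TopCat.Presheaf.stalkFunctor_map_germ_apply
    ((Opens.map φ).obj U) y hy (toPull φ F) _).trans ?_)
  rw [← presheafUnit_toPull]
  rfl

variable {φ} {F F' : Shv k X}

theorem stalkMap_pull_stalkEquiv (f : F ⟶ F') (y : Y) {x : X} (h : φ y = x) (a : Stalk F x) :
    stalkMap ((pull φ k).map f) y (stalkEquiv φ F y h a) =
      stalkEquiv φ F' y h (stalkMap f x a) := by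
  subst h
  obtain ⟨U, hyU, s, rfl⟩ := exists_germ a
  rw [stalkMap_germ, stalkEquiv_germ φ F rfl hyU hyU, stalkEquiv_germ φ F' rfl hyU hyU]
  refine (stalkMap_germ ((pull φ k).map f) (U := (Opens.map φ).obj U) hyU _).trans ?_
  exact congrArg (fun b => germ ((pull φ k).obj F') _ y hyU (b.hom s)) (unitApp_naturality φ k f U)

/-- The map `(φ⁻¹ F)_{g y} ⟶ (φ⁻¹ F)_y` induced on germs by `s ↦ s ∘ g`. -/
noncomputable def deckStalk (g : Deck φ) (F : Shv k X) (y : Y) :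
    Stalk ((pull φ k).obj F) (g.1 y) →ₗ[k] Stalk ((pull φ k).obj F) y :=
  (TopCat.Presheaf.stalkPushforward (ModuleCat.{u} k) (deckHom φ g) ((pull φ k).obj F).1 y).hom ∘ₗ
    stalkMap (deckPull φ k g F) (g.1 y)

theorem deckStalk_germ (g : Deck φ) {V : Opens Y} {y : Y} (hy : g.1 y ∈ V)
    (s : ((pull φ k).obj F).1.obj (op V)) :
    deckStalk g F y (germ _ V (g.1 y) hy s) =
      germ ((pull φ k).obj F) ((Opens.map (deckHom φ g)).obj V) y hy
        ((deckPullApp g F V).hom s) :=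
  (congrArg (TopCat.Presheaf.stalkPushforward (ModuleCat.{u} k) (deckHom φ g)
    ((pull φ k).obj F).1 y).hom (stalkMap_germ (deckPull φ k g F) hy s)).trans
    (congrArg (fun a => a.hom ((deckPullApp g F V).hom s))
      (TopCat.Presheaf.stalkPushforward_germ (ModuleCat.{u} k) (deckHom φ g) _ V y hy))

theorem deckStalk_stalkEquiv (g : Deck φ) (y : Y) {x : X} (h : φ y = x) (a : Stalk F x) :
    deckStalk g F y (stalkEquiv φ F (g.1 y) ((g.2 y).trans h) a) = stalkEquiv φ F y h a := by
  subst h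
  obtain ⟨U, hyU, s, rfl⟩ := exists_germ a
  have hgyU : φ (g.1 y) ∈ U := (g.2 y).symm ▸ hyU
  rw [stalkEquiv_germ φ F rfl hyU hyU, stalkEquiv_germ φ F (g.2 y) hyU hgyU]
  refine (deckStalk_germ g (V := (Opens.map φ).obj U) hgyU _).trans ?_
  refine (congrArg (fun b => germ ((pull φ k).obj F) _ y hgyU (b.hom s))
    (unit_deckPull φ k g F U)).trans ?_
  exact germ_res (preimage_deckHom_le g U) hgyU _

variable (φ) in
/-- The value at `y` of a global section of `φ⁻¹ F`, in the stalk of `F` at `x = φ y`. -/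
noncomputable def value (y : Y) {x : X} (h : φ y = x) : (sectionsRep φ k).obj F →ₗ[k] Stalk F x :=
  (stalkEquiv φ F y h).symm.toLinearMap ∘ₗ germ ((pull φ k).obj F) ⊤ y trivial

theorem stalkEquiv_value (y : Y) {x : X} (h : φ y = x) (s : (sectionsRep φ k).obj F) :
    stalkEquiv φ F y h (value φ y h s) = germ ((pull φ k).obj F) ⊤ y trivial s :=
  (stalkEquiv φ F y h).apply_symm_apply _

theorem value_ext {s t : (sectionsRep φ k).obj F}
    (h : ∀ y, value φ y rfl s = value φ y rfl t) : s = t :=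
  section_ext (F := (pull φ k).obj F) (U := ⊤) fun y _ =>
    (stalkEquiv φ F y rfl).symm.injective (h y)

theorem value_map (f : F ⟶ F') (y : Y) {x : X} (h : φ y = x) (s : (sectionsRep φ k).obj F) :
    value φ y h (((sectionsRep φ k).map f).hom s) = stalkMap f x (value φ y h s) := by
  refine (stalkEquiv φ F' y h).injective ?_
  rw [stalkEquiv_value, ← stalkMap_pull_stalkEquiv, stalkEquiv_value]
  exact (stalkMap_germ ((pull φ k).map f) (U := ⊤) trivial s).symm

theorem value_rho (g : Deck φ) (y : Y) {x : X} (h : φ y = x) (s : (sectionsRep φ k).obj F) :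
    value φ y h (((sectionsRep φ k).obj F).ρ g s) =
      value φ (g⁻¹.1 y) ((g⁻¹.2 y).trans h) s := by
  refine (stalkEquiv φ F y h).injective ?_
  rw [stalkEquiv_value, ← deckStalk_stalkEquiv g⁻¹ y h, stalkEquiv_value]
  exact (deckStalk_germ g⁻¹ (V := ⊤) trivial s).symm

theorem eventually_value_eq_germ (s : (sectionsRep φ k).obj F) {y : Y} {U : Opens X}
    {hyU : φ y ∈ U} {t : F.1.obj (op U)} (h : value φ y rfl s = germ F U (φ y) hyU t) :
    ∀ᶠ z in 𝓝 y, ∃ hz : φ z ∈ U, value φ z rfl s = germ F U (φ z) hz t := by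
  have hst : germ ((pull φ k).obj F) ⊤ y trivial s =
      germ ((pull φ k).obj F) ((Opens.map φ).obj U) y hyU ((unitApp F U).hom t) := by
    rw [← stalkEquiv_germ φ F rfl hyU hyU, ← h, stalkEquiv_value]
  filter_upwards [eventually_germ_eq hst] with z ⟨_, hzU, hz⟩
  refine ⟨hzU, (stalkEquiv φ F z rfl).injective ?_⟩
  rw [stalkEquiv_value, stalkEquiv_germ φ F rfl hzU hzU, hz]

theorem exists_value_eq (a : ∀ y, Stalk F (φ y))
    (h : ∀ y, ∃ (U : Opens X) (t : F.1.obj (op U)),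
      ∀ᶠ z in 𝓝 y, ∃ hz : φ z ∈ U, germ F U (φ z) hz t = a z) :
    ∃ s : (sectionsRep φ k).obj F, ∀ y, value φ y rfl s = a y := by
  obtain ⟨s, hs⟩ := exists_section (F := (pull φ k).obj F) (U := ⊤)
    (fun y _ => stalkEquiv φ F y rfl (a y)) fun y _ => by
      obtain ⟨U, t, ht⟩ := h y
      refine ⟨(Opens.map φ).obj U, (unitApp F U).hom t, ht.mono fun z ⟨hzU, hz⟩ => ⟨hzU, ?_⟩⟩
      rw [← hz, stalkEquiv_germ φ F rfl hzU hzU]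
      exact fun _ => rfl
  exact ⟨s, fun y => (stalkEquiv φ F y rfl).injective ((stalkEquiv_value ..).trans (hs y trivial))⟩

end InverseImage

section AssocStalks

variable {X Y : TopCat.{u}} {φ : Y ⟶ X} {k : Type u} [Ring k] {E : Rep.{u} k (Deck φ)} {x : X}

theorem Fibre.mk_deck (g : Deck φ) (y : Y) (h : φ y = x) (e : E) :
    Fibre.mk (g.1 y) ((g.2 y).trans h) (E.ρ g e) = Fibre.mk y h e := by
  refine Fibre.ext (Eq.symm ?_)
  exact AssocSpace.mk_eq_mk.2 ⟨g, rfl, rfl⟩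

theorem Fibre.mk_congr {y z : Y} (hyz : y = z) (hy : φ y = x) (hz : φ z = x) (e : E) :
    Fibre.mk y hy e = Fibre.mk z hz e := by
  subst hyz
  rfl

variable (φ) [IsUniversalCovering φ]

theorem isLocalHomeomorph : IsLocalHomeomorph φ :=
  (IsUniversalCovering.isCoveringMap (φ := φ)).isLocalHomeomorph

theorem eventually_nhds_iff_comp (y : Y) {p : X → Prop} :
    (∀ᶠ x in 𝓝 (φ y), p x) ↔ ∀ᶠ z in 𝓝 y, p (φ z) := by
  rw [← (isLocalHomeomorph φ).map_nhds_eq, Filter.eventually_map]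

theorem exists_injOn (y : Y) : ∃ V : Opens Y, y ∈ V ∧ Set.InjOn φ V := by
  obtain ⟨f, hyf, hf⟩ := isLocalHomeomorph φ y
  exact ⟨⟨f.source, f.open_source⟩, hyf, hf ▸ f.injOn⟩

/-- The image of an open set under a universal covering, as an open set. -/
def openImage (V : Opens Y) : Opens X := ⟨φ '' V, (isLocalHomeomorph φ).isOpenMap V V.isOpen⟩

variable {φ}

theorem mem_openImage {V : Opens Y} {y : Y} (hy : y ∈ V) (h : φ y = x) : x ∈ openImage φ V :=
  ⟨y, hy, h⟩

variable [ConnectedSpace X]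

theorem continuous_localSection {V : Opens Y} (hV : Set.InjOn φ V) (e : E) :
    Continuous fun x : openImage φ V =>
      (Fibre.mk (E := E) x.2.choose x.2.choose_spec.2 e).val := by
  refine (continuous_iff (openImage φ V) _).2 ?_
  rintro y ⟨y', hy', h⟩
  obtain ⟨g, hg⟩ := exists_deck φ h.symm
  refine ⟨E.ρ g⁻¹ e, ?_⟩
  have hgV : g.1 ⁻¹' V ∈ 𝓝 y :=
    (V.isOpen.preimage g.1.continuous).mem_nhds (show g.1 y ∈ V from hg.symm ▸ hy')
  filter_upwards [hgV] with z hz hzU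
  have hgz : hzU.choose = g.1 z :=
    hV hzU.choose_spec.1 hz (hzU.choose_spec.2.trans (g.2 z).symm)
  rw [← Fibre.mk_deck g z rfl, E.ρ.self_inv_apply]
  exact Fibre.mk_congr hgz _ _ e

variable (E) in
/-- The sections `φ z ↦ [z, e]` over `φ V`, for `φ` injective on `V`. -/
noncomputable def localSection {V : Opens Y} (hV : Set.InjOn φ V) :
    E →ₗ[k] ((assocFunctor φ k).obj E).1.obj (op (openImage φ V)) where
  toFun e := ⟨_, continuous_localSection hV e⟩
  map_add' e f := Subtype.ext (funext fun _ => Fibre.mk_add _ _ e f)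
  map_smul' c e := Subtype.ext (funext fun _ => Fibre.mk_smul _ _ c e)

theorem localSection_apply {V : Opens Y} (hV : Set.InjOn φ V) (e : E) {z : Y} (hz : z ∈ V)
    (h : φ z = x) (hx : x ∈ openImage φ V) :
    (localSection E hV e).1 ⟨x, hx⟩ = Fibre.mk z h e :=
  Fibre.mk_congr (hV hx.choose_spec.1 hz (hx.choose_spec.2.trans h.symm)) _ _ e

theorem eventually_eq_mk {U : Opens X} {s : ((assocFunctor φ k).obj E).1.obj (op U)} {y : Y}
    {hy : φ y ∈ U} {e : E} (h : s.1 ⟨φ y, hy⟩ = Fibre.mk y rfl e) :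
    ∀ᶠ z in 𝓝 y, ∀ hz : φ z ∈ U, s.1 ⟨φ z, hz⟩ = Fibre.mk z rfl e :=
  (continuousAt_iff U s.1 y hy e h).1 s.2.continuousAt

theorem germ_eq_germ_of_eventually_eq {U V : Opens X} (hU : x ∈ U) (hV : x ∈ V)
    {s : ((assocFunctor φ k).obj E).1.obj (op U)} {t : ((assocFunctor φ k).obj E).1.obj (op V)}
    (h : ∀ᶠ z in 𝓝 x, ∀ (hzU : z ∈ U) (hzV : z ∈ V), s.1 ⟨z, hzU⟩ = t.1 ⟨z, hzV⟩) :
    germ ((assocFunctor φ k).obj E) U x hU s = germ ((assocFunctor φ k).obj E) V x hV t := by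
  obtain ⟨W, hW, hWo, hxW⟩ := eventually_nhds_iff.1 h
  let W' : Opens X := ⟨W, hWo⟩ ⊓ (U ⊓ V)
  have hW'U : W' ≤ U := inf_le_right.trans inf_le_left
  have hW'V : W' ≤ V := inf_le_right.trans inf_le_right
  have hxW' : x ∈ W' := ⟨hxW, hU, hV⟩
  have hst : res ((assocFunctor φ k).obj E) hW'U s = res ((assocFunctor φ k).obj E) hW'V t :=
    Subtype.ext (funext fun z => hW z.1 z.2.1 (hW'U z.2) (hW'V z.2))
  rw [← germ_res hW'U hxW', hst, germ_res]

theorem germ_eq_germ_iff {U V : Opens X} (hU : x ∈ U) (hV : x ∈ V)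
    (s : ((assocFunctor φ k).obj E).1.obj (op U)) (t : ((assocFunctor φ k).obj E).1.obj (op V)) :
    germ ((assocFunctor φ k).obj E) U x hU s = germ ((assocFunctor φ k).obj E) V x hV t ↔
      s.1 ⟨x, hU⟩ = t.1 ⟨x, hV⟩ := by
  constructor
  · intro h
    obtain ⟨W, hxW, iU, iV, hst⟩ :=
      TopCat.Presheaf.germ_eq ((assocFunctor φ k).obj E).1 x hU hV s t h
    exact congrArg (fun (a : ((assocFunctor φ k).obj E).1.obj (op W)) => a.1 ⟨x, hxW⟩) hst
  · intro h
    obtain ⟨y, rfl⟩ := surjective φ x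
    obtain ⟨e, he⟩ := (Fibre.mk_bijective φ E y rfl).2 (s.1 ⟨φ y, hU⟩)
    refine germ_eq_germ_of_eventually_eq hU hV ((eventually_nhds_iff_comp φ y).2 ?_)
    filter_upwards [eventually_eq_mk he.symm, eventually_eq_mk (he.trans h).symm]
      with z hs ht hzU hzV
    rw [hs, ht]

/-- The element of the stalk of `𝓛_E` at `x = φ y` given by the point `[y, e]` of the fibre. -/
noncomputable def stalkMk (y : Y) (h : φ y = x) : E →ₗ[k] Stalk ((assocFunctor φ k).obj E) x :=
  germ ((assocFunctor φ k).obj E) (openImage φ (exists_injOn φ y).choose) x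
      (mem_openImage (exists_injOn φ y).choose_spec.1 h) ∘ₗ
    localSection E (exists_injOn φ y).choose_spec.2

theorem germ_eq_stalkMk_iff {U : Opens X} {y : Y} (h : φ y = x) (hx : x ∈ U)
    (s : ((assocFunctor φ k).obj E).1.obj (op U)) (e : E) :
    germ ((assocFunctor φ k).obj E) U x hx s = stalkMk y h e ↔
      s.1 ⟨x, hx⟩ = Fibre.mk y h e := by
  refine (germ_eq_germ_iff hx _ s _).trans ?_
  rw [localSection_apply _ e (exists_injOn φ y).choose_spec.1 h]

theorem stalkMk_eq_stalkMk_iff {y z : Y} (hy : φ y = x) (hz : φ z = x) (e f : E) :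
    stalkMk y hy e = stalkMk z hz f ↔ Fibre.mk y hy e = Fibre.mk z hz f := by
  refine (germ_eq_stalkMk_iff hz _ _ f).trans ?_
  rw [localSection_apply _ e (exists_injOn φ y).choose_spec.1 hy]

theorem stalkMk_bijective (y : Y) (h : φ y = x) : Function.Bijective (stalkMk (E := E) y h) := by
  refine ⟨fun e f hef => ?_, fun a => ?_⟩
  · exact (Fibre.mk_bijective φ E y h).1 ((stalkMk_eq_stalkMk_iff h h e f).1 hef)
  · obtain ⟨U, hx, s, rfl⟩ := exists_germ a
    obtain ⟨e, he⟩ := (Fibre.mk_bijective φ E y h).2 (s.1 ⟨x, hx⟩)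
    exact ⟨e, ((germ_eq_stalkMk_iff h hx s e).2 he.symm).symm⟩

theorem stalkMk_deck (g : Deck φ) (y : Y) (h : φ y = x) (e : E) :
    stalkMk (g.1 y) ((g.2 y).trans h) (E.ρ g e) = stalkMk y h e :=
  (stalkMk_eq_stalkMk_iff _ h _ _).2 (Fibre.mk_deck g y h e)

theorem stalkMk_rho (g : Deck φ) (y : Y) (h : φ y = x) (e : E) :
    stalkMk y h (E.ρ g e) = stalkMk (g⁻¹.1 y) ((g⁻¹.2 y).trans h) e := by
  rw [← stalkMk_deck g⁻¹ y h, E.ρ.inv_self_apply]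

theorem germ_localSection {V : Opens Y} (hV : Set.InjOn φ V) (e : E) {y : Y} (hy : y ∈ V)
    (h : φ y = x) :
    germ ((assocFunctor φ k).obj E) (openImage φ V) x (mem_openImage hy h) (localSection E hV e) =
      stalkMk y h e :=
  (germ_eq_stalkMk_iff h _ _ e).2 (localSection_apply hV e hy h _)

theorem eventually_germ_eq_stalkMk {U : Opens X} {y : Y} {hy : φ y ∈ U}
    {s : ((assocFunctor φ k).obj E).1.obj (op U)} {e : E}
    (h : germ ((assocFunctor φ k).obj E) U (φ y) hy s = stalkMk y rfl e) :
    ∀ᶠ z in 𝓝 y, ∀ hz : φ z ∈ U,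
      germ ((assocFunctor φ k).obj E) U (φ z) hz s = stalkMk z rfl e :=
  (eventually_eq_mk ((germ_eq_stalkMk_iff rfl hy s e).1 h)).mono fun _ hz hzU =>
    (germ_eq_stalkMk_iff rfl hzU s e).2 (hz hzU)

theorem stalkMap_stalkMk {E' : Rep.{u} k (Deck φ)} (f : E ⟶ E') (y : Y) (h : φ y = x) (e : E) :
    stalkMap ((assocFunctor φ k).map f) x (stalkMk y h e) = stalkMk y h (f.hom e) := by
  obtain ⟨U, hx, s, hs⟩ := exists_germ (stalkMk y h e)
  have hse := (germ_eq_stalkMk_iff h hx s e).1 hs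
  rw [← hs]
  refine (stalkMap_germ ((assocFunctor φ k).map f) hx s).trans
    ((germ_eq_stalkMk_iff h hx _ _).2 ?_)
  exact (congrArg (Fibre.map f) hse).trans (Fibre.map_mk f y h e)

theorem hom_ext_stalkMk {F : Shv k X} {f g : (assocFunctor φ k).obj E ⟶ F}
    (h : ∀ (y : Y) (e : E), stalkMap f (φ y) (stalkMk y rfl e) =
      stalkMap g (φ y) (stalkMk y rfl e)) : f = g := by
  refine hom_ext_stalkMap fun x => LinearMap.ext fun a => ?_
  obtain ⟨y, rfl⟩ := surjective φ x
  obtain ⟨e, rfl⟩ := (stalkMk_bijective y rfl).2 a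
  exact h y e

end AssocStalks

section Adjunction

variable {X Y : TopCat.{u}} (φ : Y ⟶ X) [IsUniversalCovering φ] [ConnectedSpace X]
  {k : Type u} [Ring k]

theorem exists_value_eq_stalkMk {E : Rep.{u} k (Deck φ)} (e : E) :
    ∃ s : (sectionsRep φ k).obj ((assocFunctor φ k).obj E),
      ∀ (y : Y) (x : X) (h : φ y = x), value φ y h s = stalkMk y h e := by
  obtain ⟨s, hs⟩ := exists_value_eq (fun y => stalkMk y rfl e) fun y => by
    obtain ⟨V, hyV, hV⟩ := exists_injOn φ y
    refine ⟨openImage φ V, localSection E hV e, ?_⟩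
    filter_upwards [V.isOpen.mem_nhds hyV] with z hz
    exact ⟨mem_openImage hz rfl, germ_localSection hV e hz rfl⟩
  exact ⟨s, by rintro y _ rfl; exact hs y⟩

theorem exists_unit (E : Rep.{u} k (Deck φ)) :
    ∃ η : E ⟶ (sectionsRep φ k).obj ((assocFunctor φ k).obj E),
      ∀ e y, value φ y rfl (η.hom e) = stalkMk y rfl e := by
  choose s hs using exists_value_eq_stalkMk φ (E := E)
  refine ⟨Rep.ofHom ⟨⟨⟨s, fun e f => ?_⟩, fun c e => ?_⟩, fun g => LinearMap.ext fun e => ?_⟩,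
    fun e y => hs e y _ rfl⟩
  · refine value_ext fun y => Eq.trans ?_ (map_add (value φ y rfl) (s e) (s f)).symm
    rw [hs, hs, hs, map_add]
  · refine value_ext fun y => Eq.trans ?_ (map_smul (value φ y rfl) c (s e)).symm
    rw [hs, hs, map_smul]
  · refine value_ext fun y => Eq.trans ?_ (value_rho g y rfl (s e)).symm
    exact (hs _ y _ rfl).trans ((stalkMk_rho g y rfl e).trans (hs ..).symm)

theorem exists_counitStalk (F : Shv k X) (x : X) :
    ∃ c : Stalk ((assocFunctor φ k).obj ((sectionsRep φ k).obj F)) x →ₗ[k] Stalk F x,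
      ∀ (y : Y) (h : φ y = x) (s : (sectionsRep φ k).obj F),
        c (stalkMk y h s) = value φ y h s := by
  obtain ⟨y, rfl⟩ := surjective φ x
  let l := LinearEquiv.ofBijective _ (stalkMk_bijective (E := (sectionsRep φ k).obj F) y rfl)
  refine ⟨value φ y rfl ∘ₗ l.symm.toLinearMap, fun z h s => ?_⟩
  obtain ⟨g, rfl⟩ := exists_deck φ h.symm
  have hs : stalkMk (g.1 y) h s = l (((sectionsRep φ k).obj F).ρ g⁻¹ s) :=
    (stalkMk_rho g⁻¹ y rfl s).symm
  rw [hs, LinearMap.comp_apply, LinearEquiv.coe_coe, l.symm_apply_apply]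
  exact value_rho g⁻¹ y rfl s

theorem exists_counit (F : Shv k X) :
    ∃ ε : (assocFunctor φ k).obj ((sectionsRep φ k).obj F) ⟶ F,
      ∀ y s, stalkMap ε (φ y) (stalkMk y rfl s) = value φ y rfl s := by
  choose c hc using exists_counitStalk φ F
  obtain ⟨ε, hε⟩ := exists_hom c fun U s => by
    refine exists_section _ fun x hx => ?_
    obtain ⟨y, rfl⟩ := surjective φ x
    obtain ⟨t, ht⟩ := (stalkMk_bijective y rfl).2 (germ _ U (φ y) hx s)
    obtain ⟨V, hyV, v, hv⟩ := exists_germ (value φ y rfl t)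
    refine ⟨V, v, (eventually_nhds_iff_comp φ y).2 ?_⟩
    filter_upwards [eventually_germ_eq_stalkMk ht.symm, eventually_value_eq_germ t hv.symm]
      with z hz ⟨hzV, hzt⟩
    exact ⟨hzV, fun hzU => by rw [hz hzU, hc, hzt]⟩
  exact ⟨ε, fun y s => by rw [hε, hc]⟩

/-- The unit `E ⟶ Γ(Y, φ⁻¹ 𝓛_E)`, sending `e` to the section `y ↦ [y, e]`. -/
noncomputable def unit (E : Rep.{u} k (Deck φ)) :
    E ⟶ (sectionsRep φ k).obj ((assocFunctor φ k).obj E) :=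
  (exists_unit φ E).choose

variable {φ} in
theorem value_unit {E : Rep.{u} k (Deck φ)} (e : E) (y : Y) :
    value φ y rfl ((unit φ E).hom e) = stalkMk y rfl e :=
  (exists_unit φ E).choose_spec e y

/-- The counit `𝓛_{Γ(Y, φ⁻¹ F)} ⟶ F`, sending `[y, s]` to the value of `s` at `y`. -/
noncomputable def counit (F : Shv k X) :
    (assocFunctor φ k).obj ((sectionsRep φ k).obj F) ⟶ F :=
  (exists_counit φ F).choose

variable {φ} in
theorem stalkMap_counit {F : Shv k X} (y : Y) (s : (sectionsRep φ k).obj F) :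
    stalkMap (counit φ F) (φ y) (stalkMk y rfl s) = value φ y rfl s :=
  (exists_counit φ F).choose_spec y s

variable (k) in
/-- The functor `E ↦ 𝓛_E` is left adjoint to `F ↦ Γ(Y, φ⁻¹ F)`. -/
noncomputable def assocAdjunction : assocFunctor φ k ⊣ sectionsRep φ k where
  unit :=
    { app := unit φ
      naturality E E' f := Rep.hom_ext <| Representation.IntertwiningMap.ext <|
        LinearMap.ext fun e => value_ext fun y => by
          refine (value_unit (f.hom e) y).trans ?_
          refine Eq.trans ?_ (value_map ((assocFunctor φ k).map f) y rfl _).symm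
          refine (stalkMap_stalkMk f y rfl e).symm.trans (congrArg _ (value_unit e y).symm) }
  counit :=
    { app := counit φ
      naturality F F' f := hom_ext_stalkMk fun y s => by
        refine (stalkMap_comp ..).trans (Eq.trans ?_ (stalkMap_comp ..).symm)
        refine (congrArg _ (stalkMap_stalkMk ((sectionsRep φ k).map f) y rfl s)).trans ?_
        refine (stalkMap_counit y _).trans ((value_map f y rfl s).trans ?_)
        exact congrArg _ (stalkMap_counit y s).symm }
  left_triangle_components E := hom_ext_stalkMk fun y e => by
    refine (stalkMap_comp ..).trans ?_
    refine (congrArg _ (stalkMap_stalkMk (unit φ E) y rfl e)).trans ?_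
    refine (stalkMap_counit y _).trans ((value_unit e y).trans ?_)
    exact (stalkMap_id _ _).symm
  right_triangle_components F := Rep.hom_ext <| Representation.IntertwiningMap.ext <|
    LinearMap.ext fun s => value_ext fun y => by
      refine (value_map (counit φ F) y rfl _).trans ?_
      exact (congrArg _ (value_unit s y)).trans (stalkMap_counit y s)

theorem unit_bijective (E : Rep.{u} k (Deck φ)) : Function.Bijective (unit φ E).hom := by
  have := (IsUniversalCovering.isSimplyConnected φ).connectedSpace
  constructor
  · intro e f hef
    let y : Y := Classical.arbitrary Y
    refine (stalkMk_bijective y rfl).1 ?_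
    rw [← value_unit, ← value_unit, hef]
  · intro s
    choose e he using fun y => (stalkMk_bijective (E := E) y rfl).2 (value φ y rfl s)
    have he' : IsLocallyConstant e := (IsLocallyConstant.iff_eventually_eq e).2 fun y => by
      obtain ⟨U, hyU, t, ht⟩ := exists_germ (value φ y rfl s)
      filter_upwards [eventually_value_eq_germ s ht.symm,
        eventually_germ_eq_stalkMk (ht.trans (he y).symm)] with z ⟨hzU, hzt⟩ hz
      exact (stalkMk_bijective z rfl).1 ((he z).trans (hzt.trans (hz hzU)))
    let y₀ : Y := Classical.arbitrary Y
    refine ⟨e y₀, value_ext fun y => ?_⟩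
    rw [value_unit, he'.apply_eq_of_preconnectedSpace y₀ y, he]

instance : IsIso (assocAdjunction φ k).unit := by
  have (E : Rep.{u} k (Deck φ)) : IsIso ((assocAdjunction φ k).unit.app E) :=
    (ConcreteCategory.isIso_iff_bijective _).2 (unit_bijective φ E)
  exact NatIso.isIso_of_isIso_app _

instance : (assocFunctor φ k).Full := (assocAdjunction φ k).fullyFaithfulLOfIsIsoUnit.full

instance : (assocFunctor φ k).Faithful := (assocAdjunction φ k).fullyFaithfulLOfIsIsoUnit.faithful

end Adjunction

section Trivializes

variable {k : Type u} [Ring k] {X : TopCat.{u}} {F F' : Shv k X} {U V : Opens X}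
  {M : Type u} [AddCommGroup M] [Module k M] {c : M →ₗ[k] F.1.obj (op U)}

/-- The family `c` of sections of `F` over `U`, parametrized by a module `M`, trivializes `F` over
`U`: it identifies `M` with the stalk of `F` at every point of `U`. -/
def Trivializes (c : M →ₗ[k] F.1.obj (op U)) : Prop :=
  ∀ x hx, Function.Bijective (germ F U x hx ∘ₗ c)

theorem Trivializes.res (h : Trivializes c) (hV : V ≤ U) : Trivializes (res F hV ∘ₗ c) := by
  intro x hx
  have germ_res_c : germ F V x hx ∘ₗ QuasiCoherator.res F hV ∘ₗ c = germ F U x (hV hx) ∘ₗ c :=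
    LinearMap.ext fun m => germ_res hV hx (c m)
  exact germ_res_c ▸ h x (hV hx)

theorem trivializes_app_comp_iff (f : F ⟶ F') [IsIso f] :
    Trivializes (app f U ∘ₗ c) ↔ Trivializes c := by
  refine forall₂_congr fun x hx => ?_
  have germ_app_c : germ F' U x hx ∘ₗ app f U ∘ₗ c = stalkMap f x ∘ₗ germ F U x hx ∘ₗ c :=
    LinearMap.ext fun m => (stalkMap_germ f hx (c m)).symm
  rw [germ_app_c, LinearMap.coe_comp]
  exact Function.Bijective.of_comp_iff' ((isIso_iff_stalkMap_bijective f).1 inferInstance x) _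

theorem Trivializes.bijective (h : Trivializes c) (hU : IsConnected (U : Set X)) :
    Function.Bijective c := by
  obtain ⟨x₀, hx₀⟩ := hU.nonempty
  refine ⟨.of_comp (f := germ F U x₀ hx₀) (h x₀ hx₀).injective, fun s => ?_⟩
  choose d hd using fun x : U => (h x.1 x.2).surjective (germ F U x.1 x.2 s)
  have locallyConstant_d : IsLocallyConstant d := by
    refine (IsLocallyConstant.iff_eventually_eq d).2 fun x => ?_
    filter_upwards [continuous_subtype_val.continuousAt.eventually (eventually_germ_eq (hd x))]
      with z hz
    obtain ⟨_, _, germ_eq⟩ := hz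
    exact (h z.1 z.2).injective ((hd z).trans germ_eq.symm)
  have : PreconnectedSpace U := Subtype.preconnectedSpace hU.isPreconnected
  refine ⟨d ⟨x₀, hx₀⟩, section_ext fun x hx => ?_⟩
  rw [locallyConstant_d.apply_eq_of_preconnectedSpace ⟨x₀, hx₀⟩ ⟨x, hx⟩]
  exact hd ⟨x, hx⟩

end Trivializes

section ConstantSheaf

variable {k : Type u} [Ring k] {X : TopCat.{u}}

/-- The functor sending a `k`-module to the constant sheaf with that value. -/
noncomputable abbrev constSheaf (k : Type u) [Ring k] (X : TopCat.{u}) :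
    ModuleCat.{u} k ⥤ Shv k X :=
  constantSheaf (Opens.grothendieckTopology X) (ModuleCat.{u} k)

/-- The constant sheaf functor is left adjoint to the global sections functor. -/
noncomputable abbrev constSheafAdj (k : Type u) [Ring k] (X : TopCat.{u}) :
    constSheaf k X ⊣ (sheafSections (Opens.grothendieckTopology X) (ModuleCat.{u} k)).obj (op ⊤) :=
  constantSheafAdj _ _ isTerminalTop

/-- The constant global sections of a constant sheaf. -/
noncomputable def constSection (M : ModuleCat.{u} k) :
    M →ₗ[k] ((constSheaf k X).obj M).1.obj (op ⊤) :=
  ((constSheafAdj k X).unit.app M).hom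

theorem germ_const_bijective (M : ModuleCat.{u} k) (x : X) :
    Function.Bijective
      (TopCat.Presheaf.germ ((Functor.const (Opens X)ᵒᵖ).obj M) ⊤ x trivial).hom := by
  refine ⟨fun m m' h => ?_, fun a => ?_⟩
  · obtain ⟨_, _, _, _, hm⟩ := TopCat.Presheaf.germ_eq ((Functor.const (Opens X)ᵒᵖ).obj M) x
      (U := ⊤) (V := ⊤) trivial trivial m m' h
    exact hm
  · obtain ⟨U, hx, m, rfl⟩ := TopCat.Presheaf.exists_germ_eq _ a
    exact ⟨m, (TopCat.Presheaf.germ_res_apply ((Functor.const (Opens X)ᵒᵖ).obj M)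
      (homOfLE le_top) x hx m).symm⟩

theorem trivializes_constSection (M : ModuleCat.{u} k) :
    Trivializes (constSection (X := X) M) := by
  intro x _
  let P : X.Presheaf (ModuleCat.{u} k) := (Functor.const _).obj M
  let J := Opens.grothendieckTopology X
  have constSection_eq : constSection M = ((toSheafify J P).app (op ⊤)).hom := by
    simp only [constSection, constantSheafAdj, Adjunction.comp_unit_app]
    rfl
  have germ_constSection : germ ((constSheaf k X).obj M) ⊤ x trivial ∘ₗ constSection M =
      ((TopCat.Presheaf.stalkFunctor (ModuleCat.{u} k) x).map (toSheafify J P)).hom ∘ₗ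
        (TopCat.Presheaf.germ P ⊤ x trivial).hom :=
    constSection_eq ▸ LinearMap.ext fun m =>
      (TopCat.Presheaf.stalkFunctor_map_germ_apply ⊤ x trivial (toSheafify J P) m).symm
  have := TopCat.Presheaf.stalkFunctor_map_unit_toSheafify_isIso x _ P
  rw [germ_constSection]
  exact ((ConcreteCategory.isIso_iff_bijective
    ((TopCat.Presheaf.stalkFunctor (ModuleCat.{u} k) x).map (toSheafify J P))).1 this).comp
      (germ_const_bijective M x)

theorem exists_trivializes_iff_nonempty_iso {F : Shv k X} {M : ModuleCat.{u} k} :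
    (∃ c : M →ₗ[k] F.1.obj (op ⊤), Trivializes c) ↔ Nonempty (F ≅ (constSheaf k X).obj M) := by
  refine ⟨fun ⟨c, hc⟩ => ?_, fun ⟨e⟩ =>
    ⟨app e.inv ⊤ ∘ₗ constSection M, (trivializes_app_comp_iff _).2 (trivializes_constSection M)⟩⟩
  let f : (constSheaf k X).obj M ⟶ F :=
    ((constSheafAdj k X).homEquiv _ _).symm (ModuleCat.ofHom c)
  have app_constSection : app f ⊤ ∘ₗ constSection M = c :=
    congrArg ModuleCat.Hom.hom <| ((constSheafAdj k X).homEquiv_unit ..).symm.trans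
      (((constSheafAdj k X).homEquiv M F).apply_symm_apply (ModuleCat.ofHom c))
  have : IsIso f := (isIso_iff_stalkMap_bijective f).2 fun x => by
    have germ_c : ⇑(germ F ⊤ x trivial ∘ₗ c) =
        stalkMap f x ∘ (germ _ ⊤ x trivial ∘ₗ constSection M) :=
      app_constSection ▸ funext fun m => (stalkMap_germ f (U := ⊤) trivial _).symm
    exact (Function.Bijective.of_comp_iff (stalkMap f x) (trivializes_constSection M x trivial)).1
      (germ_c ▸ hc x trivial)
  exact ⟨(asIso f).symm⟩

end ConstantSheaf

section Restriction

variable {k : Type u} [Ring k] {X : TopCat.{u}} {F : Shv k X}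

theorem trivializes_restrict_iff {U : Opens X} {W : Opens (TopCat.of U)} {M : Type u}
    [AddCommGroup M] [Module k M]
    (c : M →ₗ[k] F.1.obj (op (U.isOpenEmbedding.isOpenMap.functor.obj W))) :
    Trivializes (F := restrict U F) (U := W) c ↔ Trivializes c := by
  let A : AlgebraicGeometry.PresheafedSpace (ModuleCat.{u} k) := ⟨X, F.1⟩
  let e (x : TopCat.of U) :=
    (AlgebraicGeometry.PresheafedSpace.restrictStalkIso A U.isOpenEmbedding x).toLinearEquiv
  have germ_restrict (x : TopCat.of U) (hx : x ∈ W) :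
      e x ∘ (germ (restrict U F) W x hx ∘ₗ c) = germ F _ x.1 (Set.mem_image_of_mem _ hx) ∘ₗ c :=
    funext fun m => congrArg (fun a => a.hom (c m)) <|
      AlgebraicGeometry.PresheafedSpace.restrictStalkIso_hom_eq_germ A U.isOpenEmbedding W x hx
  have bijective_iff (x : TopCat.of U) (hx : x ∈ W) :=
    (Function.Bijective.of_comp_iff' (e x).bijective (germ (restrict U F) W x hx ∘ₗ c)).symm.trans
      (iff_of_eq (congrArg _ (germ_restrict x hx)))
  refine ⟨?_, fun h x hx => (bijective_iff x hx).2 (h _ _)⟩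
  rintro h _ ⟨x, hx, rfl⟩
  exact (bijective_iff x hx).1 (h x hx)

theorem isLocallyConstantSheaf_iff : IsLocallyConstantSheaf F ↔ ∀ x : X,
    ∃ (U : Opens X) (_ : x ∈ U) (M : ModuleCat.{u} k) (c : M →ₗ[k] F.1.obj (op U)),
      Trivializes c := by
  refine forall_congr' fun x => ⟨?_, ?_⟩
  · rintro ⟨U, hx, M, e⟩
    obtain ⟨c, hc⟩ := exists_trivializes_iff_nonempty_iso.2 e
    exact ⟨_, Set.mem_image_of_mem Subtype.val (Set.mem_univ (⟨x, hx⟩ : U)), M, c,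
      (trivializes_restrict_iff c).1 hc⟩
  · rintro ⟨U, hx, M, c, hc⟩
    exact ⟨U, hx, M, exists_trivializes_iff_nonempty_iso.1
      ⟨_, (trivializes_restrict_iff (W := ⊤) _).2 (hc.res U.isOpenEmbedding_obj_top.le)⟩⟩

end Restriction

section Presentation

variable {k : Type u} [Ring k]

theorem exists_epi_free (M : ModuleCat.{u} k) :
    ∃ p : (∐ fun _ : M => ModuleCat.of k k) ⟶ M, Epi p := by
  let p (m : M) : ModuleCat.of k k ⟶ M := ModuleCat.ofHom (LinearMap.toSpanSingleton k M m)
  refine ⟨Sigma.desc p, (ModuleCat.epi_iff_surjective _).2 fun m =>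
    ⟨Sigma.ι (fun _ : M => ModuleCat.of k k) m (1 : k), ?_⟩⟩
  exact (congrArg (fun a => a.hom (1 : k)) (Sigma.ι_desc p m)).trans (one_smul k m)

theorem exists_free_presentation (M : ModuleCat.{u} k) :
    ∃ (I J : Type u) (f : (∐ fun _ : I => ModuleCat.of k k) ⟶ (∐ fun _ : J => ModuleCat.of k k))
      (g : (∐ fun _ : J => ModuleCat.of k k) ⟶ M) (w : f ≫ g = 0),
      (ShortComplex.mk f g w).Exact ∧ Epi g := by
  obtain ⟨g, hg⟩ := exists_epi_free M
  obtain ⟨q, hq⟩ := exists_epi_free (kernel g)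
  have w : (q ≫ kernel.ι g) ≫ g = 0 := by simp
  refine ⟨_, _, q ≫ kernel.ι g, g, w, ?_, hg⟩
  rw [ShortComplex.exact_iff_epi_kernel_lift]
  have lift_eq : kernel.lift g (q ≫ kernel.ι g) w = q := by
    rw [← cancel_mono (kernel.ι g), kernel.lift_ι]
  exact lift_eq.symm ▸ hq

instance (X : TopCat.{u}) : (constSheaf k X).IsLeftAdjoint := (constSheafAdj k X).isLeftAdjoint

/-- The constant sheaf with value the free module on `I` is the free sheaf on `I`. -/
noncomputable def constSheafFreeIso (k : Type u) [Ring k] (X : TopCat.{u}) (I : Type u) :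
    (constSheaf k X).obj (∐ fun _ : I => ModuleCat.of k k) ≅ freeSheaf k X I :=
  PreservesCoproduct.iso (constSheaf k X) _

theorem exists_freeSheaf_presentation {X : TopCat.{u}} {F : Shv k X} {M : ModuleCat.{u} k}
    (e : F ≅ (constSheaf k X).obj M) :
    ∃ (I J : Type u) (f : freeSheaf k X I ⟶ freeSheaf k X J) (g : freeSheaf k X J ⟶ F)
      (w : f ≫ g = 0), (ShortComplex.mk f g w).Exact ∧ Epi g := by
  obtain ⟨I, J, f, g, w, exact_fg, hg⟩ := exists_free_presentation M
  have := Functor.preservesZeroMorphisms_of_isLeftAdjoint (constSheaf k X)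
  have exact_map := exact_fg.map_of_epi_of_preservesCokernel (constSheaf k X) hg inferInstance
  refine ⟨I, J,
    (constSheafFreeIso k X I).inv ≫ (constSheaf k X).map f ≫ (constSheafFreeIso k X J).hom,
    (constSheafFreeIso k X J).inv ≫ (constSheaf k X).map g ≫ e.inv, ?_, ?_, inferInstance⟩
  · simp [← Functor.map_comp_assoc, w]
  · exact (ShortComplex.exact_iff_of_iso (ShortComplex.isoMk (constSheafFreeIso k X I)
      (constSheafFreeIso k X J) e.symm (Iso.hom_inv_id_assoc _ _)
      (Iso.hom_inv_id_assoc _ _))).1 exact_map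

theorem IsLocallyConstantSheaf.isQuasicoherent {X : TopCat.{u}} {F : Shv k X}
    (h : IsLocallyConstantSheaf F) : IsQuasicoherent k X F := fun x =>
  let ⟨U, hx, _, ⟨e⟩⟩ := h x
  ⟨U, hx, exists_freeSheaf_presentation e⟩

end Presentation

section Cokernel

variable {k : Type u} [Ring k] {X : TopCat.{u}}

theorem stalkMap_exact {A B F : Shv k X} {f : A ⟶ B} {g : B ⟶ F} {w : f ≫ g = 0}
    (h : (ShortComplex.mk f g w).Exact) (hg : Epi g) (x : X) :
    Function.Exact (stalkMap f x) (stalkMap g x) ∧ Function.Surjective (stalkMap g x) := by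
  let G : Shv k X ⥤ ModuleCat.{u} k :=
    TopCat.Sheaf.forget (ModuleCat.{u} k) X ⋙ TopCat.Presheaf.stalkFunctor (ModuleCat.{u} k) x
  have : G.IsLeftAdjoint := inferInstanceAs (TopCat.Sheaf.forget (ModuleCat.{u} k) X ⋙
    TopCat.Presheaf.stalkFunctor (ModuleCat.{u} k) x).IsLeftAdjoint
  have := Functor.preservesZeroMorphisms_of_isLeftAdjoint G
  exact ⟨(ShortComplex.ShortExact.moduleCat_exact_iff_function_exact _).1
      (h.map_of_epi_of_preservesCokernel G hg inferInstance),
    (ModuleCat.epi_iff_surjective (G.map g)).1 inferInstance⟩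

theorem liftQ_range_bijective {M N P : Type*} [AddCommGroup M] [AddCommGroup N] [AddCommGroup P]
    [Module k M] [Module k N] [Module k P] {f : M →ₗ[k] N} {g : N →ₗ[k] P}
    (hfg : Function.Exact f g) (hg : Function.Surjective g) :
    Function.Bijective
      (f.range.liftQ g (LinearMap.range_le_ker_iff.2 hfg.linearMap_comp_eq_zero)) :=
  ⟨LinearMap.ker_eq_bot.1 (Submodule.ker_liftQ_eq_bot' _ _ hfg.linearMap_ker_eq.symm),
    LinearMap.range_eq_top.1 ((Submodule.range_liftQ ..).trans (LinearMap.range_eq_top.2 hg))⟩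

theorem exists_trivializes_cokernel {A B F : Shv k X} {f : A ⟶ B} {g : B ⟶ F} {w : f ≫ g = 0}
    (h : (ShortComplex.mk f g w).Exact) (hg : Epi g) {U : Opens X} (hU : IsConnected (U : Set X))
    {M N : ModuleCat.{u} k} {a : M →ₗ[k] A.1.obj (op U)} {b : N →ₗ[k] B.1.obj (op U)}
    (ha : Trivializes a) (hb : Trivializes b) :
    ∃ (Q : ModuleCat.{u} k) (c : Q →ₗ[k] F.1.obj (op U)), Trivializes c := by
  let f₀ : M →ₗ[k] N := (LinearEquiv.ofBijective b (hb.bijective hU)).symm ∘ₗ app f U ∘ₗ a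
  have b_f₀ (m : M) : b (f₀ m) = app f U (a m) :=
    (LinearEquiv.ofBijective b (hb.bijective hU)).apply_symm_apply _
  have app_comp (s : A.1.obj (op U)) : app g U (app f U s) = 0 :=
    congrArg (fun e : A ⟶ F => app e U s) w
  have range_le : f₀.range ≤ LinearMap.ker (app g U ∘ₗ b) := by
    rintro _ ⟨m, rfl⟩
    simp only [LinearMap.mem_ker, LinearMap.comp_apply, b_f₀, app_comp]
  refine ⟨ModuleCat.of k (N ⧸ f₀.range), f₀.range.liftQ (app g U ∘ₗ b) range_le, fun x hx => ?_⟩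
  let a' := LinearEquiv.ofBijective _ (ha x hx)
  let b' := LinearEquiv.ofBijective _ (hb x hx)
  obtain ⟨exact_stalk, surjective_stalk⟩ := stalkMap_exact h hg x
  have exact_f₀ : Function.Exact f₀ (stalkMap g x ∘ₗ b'.toLinearMap) := by
    refine (Function.Exact.iff_of_ladder_linearEquiv (g₁₂ := stalkMap f x) (g₂₃ := stalkMap g x)
      (e₁ := a') (e₂ := b') (e₃ := .refl k _) (LinearMap.ext fun m => ?_) rfl).1 exact_stalk
    exact (stalkMap_germ f hx (a m)).trans (congrArg (germ B U x hx) (b_f₀ m).symm)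
  convert liftQ_range_bijective exact_f₀ (surjective_stalk.comp b'.surjective) using 2
  refine Submodule.linearMap_qext _ (LinearMap.ext fun n => ?_)
  exact (stalkMap_germ g hx (b n)).symm

theorem exists_trivializes_freeSheaf (k : Type u) [Ring k] (X : TopCat.{u}) (I : Type u) :
    ∃ (M : ModuleCat.{u} k) (c : M →ₗ[k] (freeSheaf k X I).1.obj (op ⊤)), Trivializes c :=
  ⟨_, exists_trivializes_iff_nonempty_iso.2 ⟨(constSheafFreeIso k X I).symm⟩⟩

theorem IsQuasicoherent.isLocallyConstantSheaf [LocallyConnectedSpace X] {F : Shv k X}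
    (hF : IsQuasicoherent k X F) : IsLocallyConstantSheaf F := by
  refine isLocallyConstantSheaf_iff.2 fun x => ?_
  obtain ⟨U, hx, I, J, f, g, w, exact_fg, hg⟩ := hF x
  have : LocallyConnectedSpace (TopCat.of U) := U.isOpen.locallyConnectedSpace
  let V : Opens (TopCat.of U) := ⟨connectedComponent ⟨x, hx⟩, isOpen_connectedComponent⟩
  obtain ⟨M, a, ha⟩ := exists_trivializes_freeSheaf k (TopCat.of U) I
  obtain ⟨N, b, hb⟩ := exists_trivializes_freeSheaf k (TopCat.of U) J
  obtain ⟨Q, c, hc⟩ := exists_trivializes_cokernel (U := V) exact_fg hg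
    isConnected_connectedComponent (ha.res le_top) (hb.res le_top)
  exact ⟨_, Set.mem_image_of_mem Subtype.val mem_connectedComponent, Q, c,
    (trivializes_restrict_iff c).1 hc⟩

end Cokernel

theorem isLocallyConstantSheaf_assocFunctor {X Y : TopCat.{u}} (φ : Y ⟶ X)
    [IsUniversalCovering φ] [ConnectedSpace X] {k : Type u} [Ring k] (E : Rep.{u} k (Deck φ)) :
    IsLocallyConstantSheaf ((assocFunctor φ k).obj E) := by
  refine isLocallyConstantSheaf_iff.2 fun x => ?_
  obtain ⟨y, rfl⟩ := surjective φ x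
  obtain ⟨V, hy, hV⟩ := exists_injOn φ y
  refine ⟨openImage φ V, mem_openImage hy rfl, ModuleCat.of k E, localSection E hV, ?_⟩
  rintro _ ⟨z, hz, rfl⟩
  have germ_comp : germ _ _ (φ z) (mem_openImage hz rfl) ∘ₗ localSection E hV =
      stalkMk (E := E) z rfl :=
    LinearMap.ext fun e => germ_localSection hV e hz rfl
  exact germ_comp ▸ stalkMk_bijective z rfl

section Monodromy

variable {k : Type u} [Ring k] {Y : TopCat.{u}} {A : Shv k Y}

theorem germ_top_injective [PreconnectedSpace Y]
    (hA : ∀ y, ∃ V : Opens Y, y ∈ V ∧ ∀ z (hz : z ∈ V), Function.Injective (germ A V z hz))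
    (y : Y) : Function.Injective (germ A ⊤ y trivial) := by
  intro s t hst
  have locallyConstant :
      IsLocallyConstant fun z => germ A ⊤ z trivial s = germ A ⊤ z trivial t := by
    refine (IsLocallyConstant.iff_eventually_eq _).2 fun x => ?_
    obtain ⟨V, hx, hV⟩ := hA x
    have germ_eq_iff (z : Y) (hz : z ∈ V) : germ A ⊤ z trivial s = germ A ⊤ z trivial t ↔
        res A le_top s = res A (le_top : V ≤ ⊤) t := by
      rw [← (hV z hz).eq_iff, germ_res, germ_res]
    filter_upwards [V.isOpen.mem_nhds hx] with z hz
    rw [germ_eq_iff z hz, germ_eq_iff x hx]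
  exact section_ext fun z _ => (locallyConstant.apply_eq_of_preconnectedSpace z y).mpr hst

theorem exists_section_of_continuous {b : ∀ y, Stalk A y}
    (hb : Continuous fun y => (⟨y, b y⟩ : TopCat.Presheaf.EtaleSpace (F := A.1))) :
    ∃ s : A.1.obj (op ⊤), ∀ y, germ A ⊤ y trivial s = b y := by
  obtain ⟨s, hs⟩ := exists_section (F := A) (U := ⊤) (fun y _ => b y) fun y _ => by
    obtain ⟨U, -, t, ht⟩ := TopCat.Presheaf.EtaleSpace.exists_section_of_tendsto (hb.tendsto y)
    exact ⟨U, t, ht.mono fun z ⟨hz, hbz⟩ => ⟨hz, fun _ => hbz.symm⟩⟩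
  exact ⟨s, fun y => hs y trivial⟩

theorem germ_top_surjective (hY : IsSimplyConnected Y)
    (hA : ∀ y, ∃ V : Opens Y, y ∈ V ∧ ∀ z (hz : z ∈ V), Function.Bijective (germ A V z hz))
    (y : Y) : Function.Surjective (germ A ⊤ y trivial) := by
  intro a
  let etaleSpace := TopCat.Presheaf.EtaleSpace (C := ModuleCat.{u} k) A.1
  obtain ⟨I, _, _, e, he⟩ := hY.exists_trivialization etaleSpace _
    (TopCat.Presheaf.EtaleSpace.isCoveringMap_base (F := A.1) hA)
  let σ (z : Y) : etaleSpace := e.symm (z, (e ⟨y, a⟩).2)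
  have base_σ (z : Y) : (σ z).base = z := by
    rw [← he (σ z), e.apply_symm_apply]
  have σ_y : σ y = ⟨y, a⟩ := e.symm_apply_eq.2 (Prod.ext (he ⟨y, a⟩).symm rfl)
  have exists_germ_eq (g : etaleSpace) : ∃ b : Stalk A g.base, g = ⟨g.base, b⟩ := ⟨g.germ, rfl⟩
  choose b hb using fun z => base_σ z ▸ exists_germ_eq (σ z)
  have continuous_σ : Continuous σ := by fun_prop
  obtain ⟨s, hs⟩ := exists_section_of_continuous (funext hb ▸ continuous_σ)
  exact ⟨s, (hs y).trans (eq_of_heq (TopCat.Presheaf.EtaleSpace.mk.inj ((hb y).symm.trans σ_y)).2)⟩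

end Monodromy

section Counit

variable {X Y : TopCat.{u}} {φ : Y ⟶ X} {k : Type u} [Ring k] {F : Shv k X}

theorem Trivializes.unitApp {U : Opens X} {M : Type u} [AddCommGroup M] [Module k M]
    {c : M →ₗ[k] F.1.obj (op U)} (h : Trivializes c) :
    Trivializes ((QuasiCoherator.unitApp (φ := φ) F U).hom ∘ₗ c) := by
  intro y hy
  have germ_unit : ⇑(germ ((pull φ k).obj F) _ y hy ∘ₗ (QuasiCoherator.unitApp F U).hom ∘ₗ c) =
      stalkEquiv φ F y rfl ∘ (germ F U (φ y) hy ∘ₗ c) :=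
    funext fun m => (stalkEquiv_germ φ F rfl hy hy (c m)).symm
  exact germ_unit ▸ (stalkEquiv φ F y rfl).bijective.comp (h (φ y) hy)

theorem locallyConnectedSpace_of_isLocalHomeomorph {A B : Type*} [TopologicalSpace A]
    [TopologicalSpace B] [LocallyConnectedSpace B] {f : A → B} (hf : IsLocalHomeomorph f) :
    LocallyConnectedSpace A :=
  let _ : ChartedSpace B A :=
    { atlas := Set.univ
      chartAt a := (hf a).choose
      mem_chart_source a := (hf a).choose_spec.1
      chart_mem_atlas _ := trivial }
  ChartedSpace.locallyConnectedSpace B A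

variable [IsUniversalCovering φ] [LocallyConnectedSpace X]

theorem value_bijective (hF : IsLocallyConstantSheaf F) (y : Y) {x : X} (h : φ y = x) :
    Function.Bijective (value (F := F) φ y h) := by
  have simplyConnected : IsSimplyConnected Y := IsUniversalCovering.isSimplyConnected φ
  have := simplyConnected.connectedSpace
  have : LocallyConnectedSpace Y := locallyConnectedSpace_of_isLocalHomeomorph (isLocalHomeomorph φ)
  have exists_bijective (z : Y) : ∃ V : Opens Y, z ∈ V ∧
      ∀ w (hw : w ∈ V), Function.Bijective (germ ((pull φ k).obj F) V w hw) := by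
    obtain ⟨U, hz, M, c, hc⟩ := isLocallyConstantSheaf_iff.1 hF (φ z)
    let U' := (Opens.map φ).obj U
    let V : Opens Y := ⟨connectedComponentIn U' z, U'.isOpen.connectedComponentIn⟩
    have hVU : V ≤ U' := connectedComponentIn_subset _ _
    have hc' := (hc.unitApp (φ := φ)).res hVU
    refine ⟨V, mem_connectedComponentIn hz, fun w hw => ?_⟩
    exact (Function.Bijective.of_comp_iff _ (hc'.bijective
      (isConnected_connectedComponentIn_iff.2 hz))).1 (hc' w hw)
  exact (stalkEquiv φ F y h).symm.bijective.comp
    ⟨germ_top_injective (fun z => (exists_bijective z).imp fun V ⟨hz, hV⟩ =>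
      ⟨hz, fun w hw => (hV w hw).injective⟩) y,
      germ_top_surjective simplyConnected exists_bijective y⟩

theorem isIso_counit [ConnectedSpace X] (hF : IsLocallyConstantSheaf F) :
    IsIso (counit φ F) := by
  refine (isIso_iff_stalkMap_bijective _).2 fun x => ?_
  obtain ⟨y, rfl⟩ := surjective φ x
  have stalkMap_comp : stalkMap (counit φ F) (φ y) ∘ stalkMk y rfl = value φ y rfl :=
    funext (stalkMap_counit y)
  exact (Function.Bijective.of_comp_iff _ (stalkMk_bijective y rfl)).1
    (stalkMap_comp ▸ value_bijective hF y rfl)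

end Counit

section Coreflective

variable {C D : Type*} [Category* C] [Category* D] {L : C ⥤ D} {R : D ⥤ C} {P : ObjectProperty D}

theorem isEquivalence_lift [L.Full] [L.Faithful] (h : ∀ c, P (L.obj c)) (hP : P ≤ L.essImage) :
    (P.lift L h).IsEquivalence where
  essSurj := ⟨fun d => ⟨(hP _ d.2).witness, ⟨P.isoMk (hP _ d.2).getIso⟩⟩⟩

/-- If `L ⊣ R` and `L` is an equivalence onto the full subcategory `P`, then `R` followed by this
equivalence is right adjoint to the inclusion of `P`. -/
noncomputable def ιAdjunction (adj : L ⊣ R) (h : ∀ c, P (L.obj c)) [(P.lift L h).IsEquivalence] :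
    P.ι ⊣ R ⋙ P.lift L h :=
  let e := (P.lift L h).asEquivalence
  (e.symm.toAdjunction.comp adj).ofNatIsoLeft (Functor.isoWhiskerRight e.counitIso P.ι)

end Coreflective

theorem IsLocallySimplyConnected.locallyConnectedSpace {X : Type u} [TopologicalSpace X]
    (hX : IsLocallySimplyConnected X) : LocallyConnectedSpace X :=
  locallyConnectedSpace_iff_subsets_isOpen_isConnected.2 fun x U hU =>
    let ⟨V, hVU, hV, hx, hVs⟩ := hX x U hU
    ⟨V, hVU, hV, hx, isConnected_iff_connectedSpace.2 hVs.connectedSpace⟩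

end QuasiCoherator

theorem mainTheorem9_general {k : Type u} [Ring k] {X Y : TopCat.{u}} [ConnectedSpace X]
    [LocallyConnectedSpace X] (φ : Y ⟶ X) [QuasiCoherator.IsUniversalCovering φ] :
    ∃ h : ∀ E : Rep.{u} k (QuasiCoherator.Deck φ),
        QuasiCoherator.IsQuasicoherent k X ((QuasiCoherator.assocFunctor φ k).obj E),
      (∀ E : Rep.{u} k (QuasiCoherator.Deck φ),
        QuasiCoherator.IsLocallyConstantSheaf ((QuasiCoherator.assocFunctor φ k).obj E)) ∧
      ((QuasiCoherator.IsQuasicoherent k X).lift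
        (QuasiCoherator.assocFunctor φ k) h).IsEquivalence ∧
      (QuasiCoherator.incl k X).IsLeftAdjoint ∧
      ∀ Qc : QuasiCoherator.Shv k X ⥤ QuasiCoherator.Qcoh k X, (QuasiCoherator.incl k X ⊣ Qc) →
        Nonempty (Qc ≅ QuasiCoherator.sectionsRep φ k ⋙
          (QuasiCoherator.IsQuasicoherent k X).lift (QuasiCoherator.assocFunctor φ k) h) := by
  have locallyConstant (E : Rep.{u} k (QuasiCoherator.Deck φ)) :=
    QuasiCoherator.isLocallyConstantSheaf_assocFunctor φ E
  have quasicoherent (E : Rep.{u} k (QuasiCoherator.Deck φ)) :=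
    (locallyConstant E).isQuasicoherent
  have le_essImage : QuasiCoherator.IsQuasicoherent k X ≤
      (QuasiCoherator.assocFunctor φ k).essImage := fun F hF =>
    have := QuasiCoherator.isIso_counit (φ := φ) hF.isLocallyConstantSheaf
    ⟨_, ⟨asIso (QuasiCoherator.counit φ F)⟩⟩
  have equivalence := QuasiCoherator.isEquivalence_lift quasicoherent le_essImage
  let adj := QuasiCoherator.ιAdjunction (QuasiCoherator.assocAdjunction φ k) quasicoherent
  exact ⟨quasicoherent, locallyConstant, equivalence, adj.isLeftAdjoint,
    fun Qc hQc => ⟨hQc.rightAdjointUniq adj⟩⟩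

theorem mainTheorem9 {k : Type u} [Ring k] {X Y : TopCat.{u}} [ConnectedSpace X]
    (hX : QuasiCoherator.IsLocallySimplyConnected X) (φ : Y ⟶ X)
    [QuasiCoherator.IsUniversalCovering φ] :
    ∃ h : ∀ E : Rep.{u} k (QuasiCoherator.Deck φ),
        QuasiCoherator.IsQuasicoherent k X ((QuasiCoherator.assocFunctor φ k).obj E),
      (∀ E : Rep.{u} k (QuasiCoherator.Deck φ),
        QuasiCoherator.IsLocallyConstantSheaf ((QuasiCoherator.assocFunctor φ k).obj E)) ∧
      ((QuasiCoherator.IsQuasicoherent k X).lift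
        (QuasiCoherator.assocFunctor φ k) h).IsEquivalence ∧
      (QuasiCoherator.incl k X).IsLeftAdjoint ∧
      ∀ Qc : QuasiCoherator.Shv k X ⥤ QuasiCoherator.Qcoh k X, (QuasiCoherator.incl k X ⊣ Qc) →
        Nonempty (Qc ≅ QuasiCoherator.sectionsRep φ k ⋙
          (QuasiCoherator.IsQuasicoherent k X).lift (QuasiCoherator.assocFunctor φ k) h) :=
  have := hX.locallyConnectedSpace
  mainTheorem9_general φ
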